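/- Let $n\ge 1$ be an integer, let $\Omega\subset\mathbb{R}^n$ be a bounded domain, let $\ell>0$, and consider the cylinder $\mathcal{C}=\Omega\times[0,\ell]\subset\mathbb{R}^{n+1}$. Denote by $0<\lambda_1(\mathcal{C})\le\lambda_2(\mathcal{C})\le\dots$ the eigenvalues of the Dirichlet Laplacian on (the interior of) $\mathcal{C}$, repeated according to multiplicity, by $|\Omega|$ the $n$-dimensional Lebesgue measure of $\Omega$, and by $\omega_d$ the volume of the unit ball of $\mathbb{R}^d$. For $d\ge 1$ put \[ \alpha_d:=\frac{d}{(d+1)^{1-\frac1d}}\left(\frac{\pi}{4}\right)^{1/d}\left[\frac{\Gamma\left(\frac{d+1}{2}\right)}{\Gamma\left(\frac{d+2}{2}\right)}\right]^{2/d},\qquad \beta_d:=\frac{d}{d+2} \] ($\beta_d$ is the Berezin–Li–Yau constant). Then for every integer $k\ge 1$ \[ \lambda_k(\mathcal{C})\ \ge\ \alpha_{n+1}\,\frac{4\pi^2}{\omega_{n+1}^{2/(n+1)}}\left(\frac{k}{\ell\,|\Omega|}\right)^{2/(n+1)} . \] Moreover, for every $n\ge 2$, \[ \beta_{n+1}<\frac{n+1}{n+2}\left(\frac{\pi}{2}\right)^{\frac1{n+1}}<\alpha_{n+1}<\frac{n+1}{n+2}\left(\frac{\pi}{2}\right)^{\frac1{n+1}}\left(\frac{n+3}{n+2}\right)^{\frac1{n+1}}<1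 . \] -/

import Mathlib

open MeasureTheory
open scoped ContDiff

noncomputable section

/-- Real-valued `L²` functions on `ℝ^d`. -/
abbrev L2Scalar (d : ℕ) : Type :=
  Lp ℝ 2 (volume : Measure (EuclideanSpace ℝ (Fin d)))

/-- `L²` vector fields on `ℝ^d`. -/
abbrev L2Field (d : ℕ) : Type :=
  Lp (EuclideanSpace ℝ (Fin d)) 2 (volume : Measure (EuclideanSpace ℝ (Fin d)))

/-- The pairs `(φ, ∇φ)`, as pairs of `L²` classes, with `φ` a smooth function whose support is
compact and contained in `U`. -/
def testPairs {d : ℕ} (U : Set (EuclideanSpace ℝ (Fin d))) : Set (L2Scalar d × L2Field d) :=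
  {p | ∃ φ : EuclideanSpace ℝ (Fin d) → ℝ,
    ContDiff ℝ ∞ φ ∧ HasCompactSupport φ ∧ tsupport φ ⊆ U ∧
    p.1 =ᵐ[volume] φ ∧ p.2 =ᵐ[volume] gradient φ}

/-- The Sobolev space `H¹₀(U)` of an open set `U`: the closure of `C_c^∞(U)` in the `H¹` norm.
An element is the pair `(u, ∇u)` of a function (extended by zero to `ℝ^d`) and its weak gradient. -/
def sobolevH10 {d : ℕ} (U : Set (EuclideanSpace ℝ (Fin d))) : Set (L2Scalar d × L2Field d) :=
  closure (testPairs U)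

/-- `w = (u, ∇u)` is an eigenfunction of the Dirichlet Laplacian on `U` with eigenvalue `μ`:
`u ∈ H¹₀(U)`, `u ≠ 0`, and `∫ ∇u · ∇v = μ ∫ u v` for every `v ∈ H¹₀(U)`. -/
def IsDirichletEigenfunction {d : ℕ} (U : Set (EuclideanSpace ℝ (Fin d))) (μ : ℝ)
    (w : L2Scalar d × L2Field d) : Prop :=
  w ∈ sobolevH10 U ∧ w.1 ≠ 0 ∧
    ∀ v ∈ sobolevH10 U, inner ℝ w.2 v.2 = μ * inner ℝ w.1 v.1

/-- The `k`-th Dirichlet eigenvalue of `U` (`k ≥ 1`), in increasing order and repeated according to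
multiplicity: the least `Λ` for which there are `k` linearly independent eigenfunctions with
eigenvalues at most `Λ`. (If there were fewer than `k` eigenvalues, the value would be `0`.) -/
def dirichletEigenvalue {d : ℕ} (U : Set (EuclideanSpace ℝ (Fin d))) (k : ℕ) : ℝ :=
  sInf {Λ : ℝ | ∃ w : Fin k → L2Scalar d × L2Field d,
    LinearIndependent ℝ (fun i => (w i).1) ∧
    ∀ i, ∃ μ ≤ Λ, IsDirichletEigenfunction U μ (w i)}

/-- The cylinder `Ω × [0, ℓ]` in `ℝ^(n+1)`; for open `Ω` its interior is `Ω × (0, ℓ)`. -/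
def closedCylinder {n : ℕ} (Ω : Set (EuclideanSpace ℝ (Fin n))) (ℓ : ℝ) :
    Set (EuclideanSpace ℝ (Fin (n + 1))) :=
  {x | WithLp.toLp 2 (fun i : Fin n => x i.castSucc) ∈ Ω ∧ x (Fin.last n) ∈ Set.Icc 0 ℓ}

/-- The volume `ω_d` of the unit ball of `ℝ^d`. -/
def unitBallVolume (d : ℕ) : ℝ :=
  volume.real (Metric.ball (0 : EuclideanSpace ℝ (Fin d)) 1)

/-- The Berezin–Li–Yau constant `β_d = d / (d + 2)`. -/
def berezinLiYauConst (d : ℕ) : ℝ := (d : ℝ) / (d + 2)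

/-- The constant `α_d = d / (d+1)^(1-1/d) · (π/4)^(1/d) · [Γ((d+1)/2) / Γ((d+2)/2)]^(2/d)`. -/
def cylinderConst (d : ℕ) : ℝ :=
  (d : ℝ) / ((d : ℝ) + 1) ^ (1 - 1 / (d : ℝ)) * (Real.pi / 4) ^ (1 / (d : ℝ)) *
    (Real.Gamma (((d : ℝ) + 1) / 2) / Real.Gamma (((d : ℝ) + 2) / 2)) ^ (2 / (d : ℝ))

end

/-! Separation of variables expresses the spectrum of the cylinder through the eigenvalues τ_m of
the cross-section, and only the cross-section is then estimated by Berezin's inequality. At most Σ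
⌊(ℓ/π)√(Λ - τ_m)⌋ eigenvalues of the cylinder are ≤ Λ, the sum running over τ_m ≤ Λ. Dropping the
floors and using √x ≤ (x + h)/(2√h) turns this into a multiple of Σ (Λ + h - τ_m), which is at most
a constant times |Ω| (Λ + h)^(1 + n/2). The quotient (Λ + h)^(1 + n/2)/√h is smallest at h = Λ/(n +
1), and solving for Λ produces α_{n+1}.

Berezin's inequality (`berezin_inequality`) holds because z‖u‖² - ‖∇u‖² is the integral of (z -
4π²|ξ|²)|û(ξ)|², where only the positive part of the weight need be kept, while Bessel's inequality
for the plane waves cut off to U gives Σ|û_i(ξ)|² ≤ |U| for an orthonormal family.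

Eigenfunctions are weak ones, so separation of variables has to be proved. The low-frequency bound
behind Berezin's inequality also yields Rellich compactness, hence completeness of the
eigenfunctions of Ω. With completeness of the sines, the products g(x) sin(jπt/ℓ) detect every
function on the cylinder that vanishes outside it (`eq_zero_of_inner_tensorLp_eq_zero`). Such a
product is orthogonal to every eigenfunction of the cylinder with a different eigenvalue, so pairing
with the finitely many products of eigenvalue ≤ Λ is injective on the span of the given
eigenfunctions (`le_sum_floor_of_linearIndependent`).

The comparison of constants rests on log-convexity of Γ and Bernoulli's inequality. -/

noncomputable section

open scoped FourierTransform LineDeriv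

/-! ### Gamma quotients and the comparison of constants -/

/-- The quotient `x Γ(x)² / Γ(x + 1/2)²` exceeds `1`. -/
theorem sq_Gamma_add_half_lt {x : ℝ} (hx : 0 < x) :
    Real.Gamma (x + 1 / 2) ^ 2 < x * Real.Gamma x ^ 2 := by
  have key : ∀ y : ℝ, 0 < y → Real.Gamma (y + 1 / 2) ^ 2 ≤ y * Real.Gamma y ^ 2 := by
    intro y hy
    have h := Real.Gamma_mul_add_mul_le_rpow_Gamma_mul_rpow_Gamma hy
      (by linarith : 0 < y + 1) (by norm_num : (0 : ℝ) < 1 / 2) (by norm_num : (0 : ℝ) < 1 / 2)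
      (by norm_num)
    rw [Real.Gamma_add_one hy.ne', ← Real.sqrt_eq_rpow, ← Real.sqrt_eq_rpow,
      show 1 / 2 * y + 1 / 2 * (y + 1) = y + 1 / 2 by ring] at h
    have hG := Real.Gamma_pos_of_pos hy
    calc Real.Gamma (y + 1 / 2) ^ 2
        ≤ (√(Real.Gamma y) * √(y * Real.Gamma y)) ^ 2 := by
          have := Real.Gamma_pos_of_pos (by linarith : 0 < y + 1 / 2)
          gcongr
      _ = y * Real.Gamma y ^ 2 := by
          rw [mul_pow, Real.sq_sqrt hG.le, Real.sq_sqrt (by positivity)]; ring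
  -- Log-convexity alone gives only ≤. Applied at x + 1 and pulled back by the functional equation
  -- it becomes strict, because x(x + 1) < (x + 1/2)².
  have h := key (x + 1) (by linarith)
  rw [show x + 1 + 1 / 2 = (x + 1 / 2) + 1 by ring, Real.Gamma_add_one (by positivity),
    Real.Gamma_add_one hx.ne'] at h
  have hG := Real.Gamma_pos_of_pos hx
  have hlt : (x + 1 / 2) ^ 2 * Real.Gamma (x + 1 / 2) ^ 2
      < (x + 1 / 2) ^ 2 * (x * Real.Gamma x ^ 2) := by
    have : 0 < x * Real.Gamma x ^ 2 := by positivity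
    nlinarith
  exact lt_of_mul_lt_mul_left hlt (by positivity)

/-- In this form the two middle inequalities of the comparison say that (d + 1)/2 times the squared
Gamma quotient lies strictly between 1 and (d + 2)/(d + 1). -/
theorem cylinderConst_eq {d : ℕ} (hd : 0 < d) :
    cylinderConst d = (d : ℝ) / (d + 1) * (Real.pi / 2 * ((d + 1) / 2 *
      (Real.Gamma (((d : ℝ) + 1) / 2) / Real.Gamma (((d : ℝ) + 2) / 2)) ^ 2)) ^ (1 / (d : ℝ)) := by
  have hd' : (0 : ℝ) < d := by exact_mod_cast hd
  have h1 := Real.Gamma_pos_of_pos (by positivity : 0 < ((d : ℝ) + 1) / 2)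
  have h2 := Real.Gamma_pos_of_pos (by positivity : 0 < ((d : ℝ) + 2) / 2)
  set r := Real.Gamma (((d : ℝ) + 1) / 2) / Real.Gamma (((d : ℝ) + 2) / 2) with hr
  have hr0 : 0 < r := by positivity
  have hpi := Real.pi_pos
  unfold cylinderConst
  rw [← hr, Real.rpow_sub (by positivity), Real.rpow_one,
    show Real.pi / 2 * ((d + 1) / 2 * r ^ 2) = ((d : ℝ) + 1) * (Real.pi / 4) * r ^ 2 by ring,
    Real.mul_rpow (by positivity) (by positivity), Real.mul_rpow (by positivity) (by positivity),
    ← Real.rpow_natCast r 2, ← Real.rpow_mul hr0.le,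
    show ((2 : ℕ) : ℝ) * (1 / d) = 2 / d by push_cast; ring]
  field_simp

theorem cylinderConst_bounds {n : ℕ} (hn : 2 ≤ n) :
    berezinLiYauConst (n + 1) <
        ((n : ℝ) + 1) / (n + 2) * (Real.pi / 2) ^ (1 / ((n : ℝ) + 1)) ∧
      ((n : ℝ) + 1) / (n + 2) * (Real.pi / 2) ^ (1 / ((n : ℝ) + 1)) < cylinderConst (n + 1) ∧
      cylinderConst (n + 1) <
        ((n : ℝ) + 1) / (n + 2) * (Real.pi / 2) ^ (1 / ((n : ℝ) + 1)) *
          (((n : ℝ) + 3) / (n + 2)) ^ (1 / ((n : ℝ) + 1)) ∧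
      ((n : ℝ) + 1) / (n + 2) * (Real.pi / 2) ^ (1 / ((n : ℝ) + 1)) *
          (((n : ℝ) + 3) / (n + 2)) ^ (1 / ((n : ℝ) + 1)) < 1 := by
  have hpi := Real.pi_pos
  have hn' : (2 : ℝ) ≤ n := by exact_mod_cast hn
  have hx : (0 : ℝ) < ((n : ℝ) + 2) / 2 := by positivity
  have hG1 := Real.Gamma_pos_of_pos hx
  have hG2 := Real.Gamma_pos_of_pos (by positivity : (0 : ℝ) < ((n : ℝ) + 3) / 2)
  have hα := cylinderConst_eq (Nat.succ_pos n)
  rw [Nat.succ_eq_add_one] at hα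
  push_cast at hα
  rw [show (n : ℝ) + 1 + 1 = n + 2 by ring, show (n : ℝ) + 1 + 2 = n + 3 by ring] at hα
  have hlow := sq_Gamma_add_half_lt hx
  -- With x = (n + 2)/2, the same inequality at x + 1/2 bounds Γ(x + 1) = xΓ(x) from above; this is
  -- the upper estimate of the quotient.
  have hupp := sq_Gamma_add_half_lt (by positivity : (0 : ℝ) < ((n : ℝ) + 3) / 2)
  rw [show ((n : ℝ) + 2) / 2 + 1 / 2 = (n + 3) / 2 by ring] at hlow
  rw [show ((n : ℝ) + 3) / 2 + 1 / 2 = (n + 2) / 2 + 1 by ring,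
    Real.Gamma_add_one hx.ne'] at hupp
  have hexp : (0 : ℝ) < 1 / ((n : ℝ) + 1) := by positivity
  refine ⟨?_, ?_, ?_, ?_⟩
  · have h1 : (1 : ℝ) < (Real.pi / 2) ^ (1 / ((n : ℝ) + 1)) :=
      Real.one_lt_rpow (by linarith [Real.pi_gt_three]) hexp
    have h2 : berezinLiYauConst (n + 1) < ((n : ℝ) + 1) / (n + 2) := by
      unfold berezinLiYauConst
      push_cast
      apply div_lt_div_of_pos_left <;> linarith
    have h3 : (0 : ℝ) < ((n : ℝ) + 1) / (n + 2) := by positivity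
    nlinarith
  · rw [hα]
    refine mul_lt_mul_of_pos_left ?_ (by positivity)
    refine Real.rpow_lt_rpow (by positivity) ?_ hexp
    refine lt_mul_of_one_lt_right (by positivity) ?_
    rw [div_pow, ← mul_div_assoc, lt_div_iff₀ (by positivity)]
    linarith
  · rw [hα, mul_assoc, ← Real.mul_rpow (by positivity) (by positivity)]
    refine mul_lt_mul_of_pos_left ?_ (by positivity)
    refine Real.rpow_lt_rpow (by positivity) ?_ hexp
    refine mul_lt_mul_of_pos_left ?_ (by positivity)
    rw [div_pow, ← mul_div_assoc, div_lt_div_iff₀ (by positivity) (by positivity)]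
    nlinarith
  · rw [mul_assoc, ← Real.mul_rpow (by positivity) (by positivity)]
    have hpow : ((n : ℝ) + 1) / (n + 2) =
        ((((n : ℝ) + 1) / (n + 2)) ^ (n + 1)) ^ (1 / ((n : ℝ) + 1)) := by
      rw [← Real.rpow_natCast, ← Real.rpow_mul (by positivity)]
      push_cast
      rw [mul_one_div_cancel (by positivity), Real.rpow_one]
    rw [hpow, ← Real.mul_rpow (by positivity) (by positivity)]
    refine Real.rpow_lt_one (by positivity) ?_ hexp
    -- Bernoulli: ((n + 2)/(n + 1))^(n+1) ≥ 2.
    have hB := one_add_mul_le_pow (a := 1 / ((n : ℝ) + 1)) (by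
      have : 0 < 1 / ((n : ℝ) + 1) := by positivity
      linarith) (n + 1)
    push_cast at hB
    rw [mul_one_div_cancel (by positivity),
      show 1 + 1 / ((n : ℝ) + 1) = (((n : ℝ) + 1) / ((n : ℝ) + 2))⁻¹ by field_simp; ring, inv_pow] at hB
    have hq : (((n : ℝ) + 1) / (n + 2)) ^ (n + 1) ≤ 1 / 2 := by
      rw [show (1 : ℝ) / 2 = 2⁻¹ by norm_num]
      exact le_inv_of_le_inv₀ (by norm_num) (by linarith)
    -- Here n ≥ 2 enters: (n + 3)/(n + 2) ≤ 5/4 and π < 3.15.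
    have hr : Real.pi / 2 * (((n : ℝ) + 3) / (n + 2)) < 2 := by
      rw [← mul_div_assoc, div_lt_iff₀ (by positivity)]
      nlinarith [Real.pi_lt_d2]
    have : 0 < Real.pi / 2 * (((n : ℝ) + 3) / (n + 2)) := by positivity
    nlinarith

/-! ### Plane waves and the Fourier transform -/

theorem memLp_indicator_cos {d : ℕ} {U : Set (EuclideanSpace ℝ (Fin d))} (hU : MeasurableSet U)
    (hfin : volume U ≠ ⊤) (θ : ℝ) (ξ : EuclideanSpace ℝ (Fin d)) :
    MemLp (U.indicator fun x => Real.cos (2 * Real.pi * inner ℝ x ξ - θ)) 2 volume := by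
  have : IsFiniteMeasure (volume.restrict U) := ⟨by simpa using hfin.lt_top⟩
  rw [memLp_indicator_iff_restrict hU]
  refine MemLp.of_bound (by fun_prop) 1 (Filter.Eventually.of_forall fun x => ?_)
  exact Real.abs_cos_le_one _

/-- The plane wave `x ↦ cos (2π⟨x, ξ⟩ - θ)`, cut off outside a set `U` of finite measure. -/
def planeWave {d : ℕ} {U : Set (EuclideanSpace ℝ (Fin d))} (hU : MeasurableSet U)
    (hfin : volume U ≠ ⊤) (θ : ℝ) (ξ : EuclideanSpace ℝ (Fin d)) : L2Scalar d :=
  (memLp_indicator_cos hU hfin θ ξ).toLp _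

theorem coeFn_planeWave {d : ℕ} {U : Set (EuclideanSpace ℝ (Fin d))} (hU : MeasurableSet U)
    (hfin : volume U ≠ ⊤) (θ : ℝ) (ξ : EuclideanSpace ℝ (Fin d)) :
    planeWave hU hfin θ ξ =ᵐ[volume]
      U.indicator fun x => Real.cos (2 * Real.pi * inner ℝ x ξ - θ) :=
  MemLp.coeFn_toLp _

/-- The squared modulus of the Fourier transform at `ξ` of a function supported in `U`. -/
def fourierPower {d : ℕ} {U : Set (EuclideanSpace ℝ (Fin d))} (hU : MeasurableSet U)
    (hfin : volume U ≠ ⊤) (u : L2Scalar d) (ξ : EuclideanSpace ℝ (Fin d)) : ℝ :=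
  inner ℝ (planeWave hU hfin 0 ξ) u ^ 2 + inner ℝ (planeWave hU hfin (Real.pi / 2) ξ) u ^ 2

theorem norm_sq_eq_integral {α E : Type*} [MeasurableSpace α] {μ : Measure α}
    [NormedAddCommGroup E] [InnerProductSpace ℝ E] (f : Lp E 2 μ) :
    ‖f‖ ^ 2 = ∫ x, ‖f x‖ ^ 2 ∂μ := by
  rw [← real_inner_self_eq_norm_sq, L2.inner_def]
  simp only [real_inner_self_eq_norm_sq]

/-- The phases 0 and π/2 give cosine and sine, whose squares add up to the indicator of U. -/
theorem norm_planeWave_sq_add {d : ℕ} {U : Set (EuclideanSpace ℝ (Fin d))} (hU : MeasurableSet U)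
    (hfin : volume U ≠ ⊤) (ξ : EuclideanSpace ℝ (Fin d)) :
    ‖planeWave hU hfin 0 ξ‖ ^ 2 + ‖planeWave hU hfin (Real.pi / 2) ξ‖ ^ 2 = volume.real U := by
  rw [norm_sq_eq_integral, norm_sq_eq_integral, ← integral_add]
  · rw [← integral_indicator_one hU]
    refine integral_congr_ae ?_
    filter_upwards [coeFn_planeWave hU hfin 0 ξ, coeFn_planeWave hU hfin (Real.pi / 2) ξ]
      with x h1 h2
    rw [h1, h2]
    by_cases hx : x ∈ U
    · simp [hx, Real.cos_sub_pi_div_two]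
    · simp [hx]
  · exact (Lp.memLp _).integrable_norm_pow (by norm_num)
  · exact (Lp.memLp _).integrable_norm_pow (by norm_num)

/-- Continuity in ξ follows from this; it provides integrability of the Fourier power and, for
Rellich's theorem, compactness of the set of waves of bounded frequency. -/
theorem dist_planeWave_le {d : ℕ} {U : Set (EuclideanSpace ℝ (Fin d))} (hU : MeasurableSet U)
    (hfin : volume U ≠ ⊤) {R : ℝ} (hR : ∀ x ∈ U, ‖x‖ ≤ R) (θ : ℝ)
    (ξ η : EuclideanSpace ℝ (Fin d)) :
    ‖planeWave hU hfin θ ξ - planeWave hU hfin θ η‖ ≤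
      2 * Real.pi * |R| * volume.real U ^ (1 / 2 : ℝ) * ‖ξ - η‖ := by
  have h := norm_indicatorConstLp (p := 2) (hs := hU) (hμs := hfin)
    (c := 2 * Real.pi * |R| * ‖ξ - η‖) (by norm_num) (by norm_num)
  have hpi := Real.pi_pos
  rw [Real.norm_of_nonneg (by positivity)] at h
  simp only [ENNReal.toReal_ofNat] at h
  rw [mul_right_comm, ← h]
  refine Lp.norm_le_norm_of_ae_le ?_
  filter_upwards [coeFn_planeWave hU hfin θ ξ, coeFn_planeWave hU hfin θ η,
    Lp.coeFn_sub (planeWave hU hfin θ ξ) (planeWave hU hfin θ η),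
    indicatorConstLp_coeFn (p := 2) (hs := hU) (hμs := hfin)
      (c := 2 * Real.pi * |R| * ‖ξ - η‖)] with x h1 h2 h3 h4
  rw [h4, h3, Pi.sub_apply, h1, h2]
  by_cases hx : x ∈ U
  · simp only [hx, Set.indicator_of_mem]
    rw [Real.norm_eq_abs, Real.norm_of_nonneg (by positivity)]
    refine (Real.abs_cos_sub_cos_le _ _).trans ?_
    rw [show 2 * Real.pi * inner ℝ x ξ - θ - (2 * Real.pi * inner ℝ x η - θ)
      = 2 * Real.pi * inner ℝ x (ξ - η) by rw [inner_sub_right]; ring, abs_mul,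
      abs_of_nonneg (by positivity : 0 ≤ 2 * Real.pi), mul_assoc (2 * Real.pi)]
    refine mul_le_mul_of_nonneg_left ((abs_real_inner_le_norm _ _).trans ?_) (by positivity)
    exact mul_le_mul_of_nonneg_right ((hR x hx).trans (le_abs_self R)) (norm_nonneg _)
  · simp [hx]

theorem continuous_planeWave {d : ℕ} {U : Set (EuclideanSpace ℝ (Fin d))} (hU : MeasurableSet U)
    (hfin : volume U ≠ ⊤) (hb : Bornology.IsBounded U) (θ : ℝ) :
    Continuous (planeWave hU hfin θ) := by
  obtain ⟨R, hR⟩ := hb.exists_norm_le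
  have : LipschitzWith (2 * Real.pi * |R| * volume.real U ^ (1 / 2 : ℝ)).toNNReal
      (planeWave hU hfin θ) := by
    refine LipschitzWith.of_dist_le_mul fun ξ η => ?_
    have hpi := Real.pi_pos
    rw [dist_eq_norm, dist_eq_norm, Real.coe_toNNReal _ (by positivity)]
    exact dist_planeWave_le hU hfin hR θ ξ η
  exact this.continuous

theorem continuous_fourierPower {d : ℕ} {U : Set (EuclideanSpace ℝ (Fin d))}
    (hU : MeasurableSet U) (hfin : volume U ≠ ⊤) (hb : Bornology.IsBounded U) (u : L2Scalar d) :
    Continuous (fourierPower hU hfin u) := by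
  have h := continuous_planeWave hU hfin hb
  unfold fourierPower
  exact (((h 0).inner continuous_const).pow 2).add (((h _).inner continuous_const).pow 2)

theorem fourierPower_le {d : ℕ} {U : Set (EuclideanSpace ℝ (Fin d))} (hU : MeasurableSet U)
    (hfin : volume U ≠ ⊤) (u : L2Scalar d) (ξ : EuclideanSpace ℝ (Fin d)) :
    fourierPower hU hfin u ξ ≤ volume.real U * ‖u‖ ^ 2 := by
  have h : ∀ θ, inner ℝ (planeWave hU hfin θ ξ) u ^ 2 ≤ ‖planeWave hU hfin θ ξ‖ ^ 2 * ‖u‖ ^ 2 := by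
    intro θ
    rw [← mul_pow, ← sq_abs]
    have := abs_real_inner_le_norm (planeWave hU hfin θ ξ) u
    gcongr
  rw [← norm_planeWave_sq_add hU hfin ξ, add_mul]
  exact add_le_add (h _) (h _)

theorem fourierPower_nonneg {d : ℕ} {U : Set (EuclideanSpace ℝ (Fin d))} (hU : MeasurableSet U)
    (hfin : volume U ≠ ⊤) (u : L2Scalar d) (ξ : EuclideanSpace ℝ (Fin d)) :
    0 ≤ fourierPower hU hfin u ξ := by
  unfold fourierPower; positivity

/-- Bessel's inequality for the cosine wave and the sine wave separately. -/
theorem sum_fourierPower_le {d : ℕ} {U : Set (EuclideanSpace ℝ (Fin d))} (hU : MeasurableSet U)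
    (hfin : volume U ≠ ⊤) {ι : Type*} [Fintype ι] {u : ι → L2Scalar d} (hu : Orthonormal ℝ u)
    (ξ : EuclideanSpace ℝ (Fin d)) :
    ∑ i, fourierPower hU hfin (u i) ξ ≤ volume.real U := by
  have h : ∀ θ, ∑ i, inner ℝ (planeWave hU hfin θ ξ) (u i) ^ 2 ≤ ‖planeWave hU hfin θ ξ‖ ^ 2 := by
    intro θ
    have := hu.sum_inner_products_le (planeWave hU hfin θ ξ) (s := Finset.univ)
    simpa only [Real.norm_eq_abs, sq_abs, real_inner_comm] using this
  unfold fourierPower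
  rw [Finset.sum_add_distrib, ← norm_planeWave_sq_add hU hfin ξ]
  exact add_le_add (h _) (h _)

theorem norm_fourier_sq_eq_fourierPower {d : ℕ} {U : Set (EuclideanSpace ℝ (Fin d))}
    (hU : MeasurableSet U) (hfin : volume U ≠ ⊤) {φ : EuclideanSpace ℝ (Fin d) → ℝ}
    (hInt : Integrable φ) (hsupp : ∀ x ∉ U, φ x = 0) {u : L2Scalar d} (hu : u =ᵐ[volume] φ)
    (ξ : EuclideanSpace ℝ (Fin d)) :
    ‖𝓕 (fun x => (φ x : ℂ)) ξ‖ ^ 2 = fourierPower hU hfin u ξ := by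
  have hin : ∀ θ, inner ℝ (planeWave hU hfin θ ξ) u
      = ∫ x, Real.cos (2 * Real.pi * inner ℝ x ξ - θ) * φ x := by
    intro θ
    rw [L2.inner_def]
    refine integral_congr_ae ?_
    filter_upwards [hu, coeFn_planeWave hU hfin θ ξ] with x h1 h2
    rw [h1, h2]
    by_cases hx : x ∈ U
    · simp [hx, mul_comm]
    · simp [hx, hsupp x hx]
  have hI : ∀ θ, Integrable fun x => Real.cos (2 * Real.pi * inner ℝ x ξ - θ) * φ x := by
    intro θ
    refine hInt.bdd_mul (c := 1) (by fun_prop) (Filter.Eventually.of_forall fun x => ?_)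
    exact Real.abs_cos_le_one _
  have hF : 𝓕 (fun x => (φ x : ℂ)) ξ = ((inner ℝ (planeWave hU hfin 0 ξ) u : ℝ) : ℂ)
      - ((inner ℝ (planeWave hU hfin (Real.pi / 2) ξ) u : ℝ) : ℂ) * Complex.I := by
    rw [Real.fourier_eq', hin, hin, ← integral_complex_ofReal, ← integral_complex_ofReal,
      ← integral_mul_const, ← integral_sub (hI 0).ofReal ((hI _).ofReal.mul_const _)]
    congr 1 with x
    rw [Complex.exp_mul_I, Real.cos_sub_pi_div_two, sub_zero, neg_mul, neg_mul,
      Complex.ofReal_neg, Complex.cos_neg, Complex.sin_neg, smul_eq_mul]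
    push_cast
    ring
  rw [hF, Complex.sq_norm, Complex.normSq_apply]
  unfold fourierPower
  simp
  ring

/-- Plancherel for φ and for each partial derivative, all regarded as complex Schwartz functions;
the transform of the i-th derivative is 2πi ξ_i times that of φ. -/
theorem integral_norm_gradient_sq {d : ℕ} {φ : EuclideanSpace ℝ (Fin d) → ℝ}
    (hφ : ContDiff ℝ ∞ φ) (hc : HasCompactSupport φ) :
    Integrable (fun ξ => ‖ξ‖ ^ 2 * ‖𝓕 (fun x => (φ x : ℂ)) ξ‖ ^ 2) ∧
    Integrable (fun ξ => ‖𝓕 (fun x => (φ x : ℂ)) ξ‖ ^ 2) ∧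
    ∫ x, φ x ^ 2 = ∫ ξ, ‖𝓕 (fun x => (φ x : ℂ)) ξ‖ ^ 2 ∧
    ∫ x, ‖gradient φ x‖ ^ 2 =
      ∫ ξ, 4 * Real.pi ^ 2 * (‖ξ‖ ^ 2 * ‖𝓕 (fun x => (φ x : ℂ)) ξ‖ ^ 2) := by
  have hc' : HasCompactSupport (fun x => (φ x : ℂ)) :=
    hc.comp_left (g := fun r : ℝ => (r : ℂ)) (by simp)
  have hs' : ContDiff ℝ ∞ (fun x => (φ x : ℂ)) := Complex.ofRealCLM.contDiff.comp hφ
  set f := hc'.toSchwartzMap hs' with hf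
  have hfx : ∀ x, f x = (φ x : ℂ) := fun x => rfl
  have hFf : ∀ ξ, (𝓕 f) ξ = 𝓕 (fun x => (φ x : ℂ)) ξ := fun ξ => rfl
  set D : Fin d → SchwartzMap (EuclideanSpace ℝ (Fin d)) ℂ :=
    fun i => ∂_{EuclideanSpace.single i (1 : ℝ)} f with hDdef
  have hD : ∀ i x, (D i) x = (((gradient φ x) i : ℝ) : ℂ) := by
    intro i x
    have hd : DifferentiableAt ℝ φ x := hφ.differentiable (by simp) x
    rw [hDdef, SchwartzMap.lineDerivOp_apply]
    have h1 : HasFDerivAt (fun x => (φ x : ℂ)) (Complex.ofRealCLM.comp (fderiv ℝ φ x)) x :=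
      Complex.ofRealCLM.hasFDerivAt.comp x hd.hasFDerivAt
    have h2 := (h1.hasLineDerivAt (EuclideanSpace.single i (1 : ℝ))).lineDeriv
    refine h2.trans ?_
    rw [ContinuousLinearMap.comp_apply, ← inner_gradient_left, EuclideanSpace.inner_single_right]
    simp
  have hFD : ∀ i ξ, ‖(𝓕 (D i)) ξ‖ ^ 2
      = 4 * Real.pi ^ 2 * (ξ i ^ 2 * ‖𝓕 (fun x => (φ x : ℂ)) ξ‖ ^ 2) := by
    intro i ξ
    rw [hDdef, SchwartzMap.fourier_lineDerivOp_eq, smul_apply,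
      SchwartzMap.smulLeftCLM_apply_apply (by fun_prop), hFf, norm_smul, norm_smul]
    rw [show inner ℝ ξ (EuclideanSpace.single i (1 : ℝ)) = ξ i by
      simp [EuclideanSpace.inner_single_right]]
    simp only [norm_mul, Complex.norm_I, Complex.norm_real, Complex.norm_ofNat, mul_one,
      Real.norm_eq_abs, mul_pow, sq_abs]
    ring
  have hInt : ∀ i : Fin d, Integrable fun ξ => ‖(𝓕 (D i)) ξ‖ ^ 2 :=
    fun i => ((𝓕 (D i)).memLp 2).integrable_norm_pow (by norm_num)
  have hInt' : ∀ i : Fin d, Integrable fun x => ‖(D i) x‖ ^ 2 :=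
    fun i => ((D i).memLp 2).integrable_norm_pow (by norm_num)
  have hsum : ∀ ξ, ∑ i, ‖(𝓕 (D i)) ξ‖ ^ 2
      = 4 * Real.pi ^ 2 * (‖ξ‖ ^ 2 * ‖𝓕 (fun x => (φ x : ℂ)) ξ‖ ^ 2) := by
    intro ξ
    simp only [hFD]
    rw [EuclideanSpace.real_norm_sq_eq, Finset.sum_mul, Finset.mul_sum]
  have hpi := Real.pi_pos
  refine ⟨?_, ?_, ?_, ?_⟩
  · have := (integrable_finsetSum Finset.univ fun i _ => hInt i).const_mul (4 * Real.pi ^ 2)⁻¹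
    simp only [hsum] at this
    refine this.congr (Filter.Eventually.of_forall fun ξ => ?_)
    field_simp
  · exact (SchwartzMap.memLp (𝓕 f) 2).integrable_norm_pow (by norm_num)
  · have := SchwartzMap.integral_norm_sq_fourier f
    simp only [hFf, hfx] at this
    rw [this]
    simp
  · simp only [← hsum]
    rw [integral_finsetSum _ fun i _ => hInt i]
    simp only [SchwartzMap.integral_norm_sq_fourier]
    rw [← integral_finsetSum _ fun i _ => hInt' i]
    congr 1 with x
    simp only [hD]
    rw [EuclideanSpace.real_norm_sq_eq]
    simp

/-! ### Low frequencies and Berezin's inequality -/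

/-- The spectral weight `(z - 4π²|ξ|²)₊`. -/
def rieszWeight (d : ℕ) (z : ℝ) (ξ : EuclideanSpace ℝ (Fin d)) : ℝ :=
  max (z - 4 * Real.pi ^ 2 * ‖ξ‖ ^ 2) 0

theorem continuous_rieszWeight (d : ℕ) (z : ℝ) : Continuous (rieszWeight d z) := by
  unfold rieszWeight; fun_prop

theorem rieszWeight_nonneg {d : ℕ} {z : ℝ} (ξ : EuclideanSpace ℝ (Fin d)) :
    0 ≤ rieszWeight d z ξ := le_max_right _ _

/-- The crude radius √|z| instead of √z/(2π) suffices for compact support and needs no sign of z. -/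
theorem rieszWeight_eq_zero {d : ℕ} {z : ℝ} {ξ : EuclideanSpace ℝ (Fin d)}
    (h : |z| < ‖ξ‖ ^ 2) : rieszWeight d z ξ = 0 := by
  refine max_eq_right ?_
  have h1 : 1 ≤ 4 * Real.pi ^ 2 := by nlinarith [Real.pi_gt_three]
  have h2 := mul_le_mul_of_nonneg_right h1 (sq_nonneg ‖ξ‖)
  linarith [le_abs_self z]

theorem hasCompactSupport_rieszWeight (d : ℕ) (z : ℝ) : HasCompactSupport (rieszWeight d z) := by
  refine HasCompactSupport.intro (isCompact_closedBall 0 (√|z|)) fun ξ hξ => ?_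
  refine rieszWeight_eq_zero ?_
  rw [mem_closedBall_zero_iff, not_le] at hξ
  exact Real.lt_sq_of_sqrt_lt hξ

theorem integrable_rieszWeight (d : ℕ) (z : ℝ) : Integrable (rieszWeight d z) :=
  (continuous_rieszWeight d z).integrable_of_hasCompactSupport (hasCompactSupport_rieszWeight d z)

theorem integrable_rieszWeight_mul_fourierPower {d : ℕ} {U : Set (EuclideanSpace ℝ (Fin d))}
    (hU : MeasurableSet U) (hfin : volume U ≠ ⊤) (hb : Bornology.IsBounded U) (z : ℝ)
    (u : L2Scalar d) : Integrable fun ξ => rieszWeight d z ξ * fourierPower hU hfin u ξ :=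
  ((continuous_rieszWeight d z).mul (continuous_fourierPower hU hfin hb u)
    ).integrable_of_hasCompactSupport (hasCompactSupport_rieszWeight d z).mul_right

theorem testPairs_energy_le {d : ℕ} {U : Set (EuclideanSpace ℝ (Fin d))}
    (hU : MeasurableSet U) (hfin : volume U ≠ ⊤) (hb : Bornology.IsBounded U) (z : ℝ)
    {w : L2Scalar d × L2Field d} (hw : w ∈ testPairs U) :
    z * ‖w.1‖ ^ 2 - ‖w.2‖ ^ 2 ≤ ∫ ξ, rieszWeight d z ξ * fourierPower hU hfin w.1 ξ := by
  obtain ⟨φ, hφ, hc, hsupp, h1, h2⟩ := hw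
  obtain ⟨hi1, hi2, he1, he2⟩ := integral_norm_gradient_sq hφ hc
  have e1 : ‖w.1‖ ^ 2 = ∫ x, φ x ^ 2 := by
    rw [norm_sq_eq_integral]
    refine integral_congr_ae ?_
    filter_upwards [h1] with x hx
    simp [hx]
  have e2 : ‖w.2‖ ^ 2 = ∫ x, ‖gradient φ x‖ ^ 2 := by
    rw [norm_sq_eq_integral]
    refine integral_congr_ae ?_
    filter_upwards [h2] with x hx
    simp [hx]
  rw [e1, e2, he1, he2, ← integral_const_mul, ← integral_sub (hi2.const_mul _) (hi1.const_mul _)]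
  refine integral_mono ((hi2.const_mul _).sub (hi1.const_mul _))
    (integrable_rieszWeight_mul_fourierPower hU hfin hb z w.1) fun ξ => ?_
  have hpow := norm_fourier_sq_eq_fourierPower hU hfin
    (hφ.continuous.integrable_of_hasCompactSupport hc)
    (fun x hx => image_eq_zero_of_notMem_tsupport fun h => hx (hsupp h)) h1 ξ
  simp only [hpow]
  have h3 : z - 4 * Real.pi ^ 2 * ‖ξ‖ ^ 2 ≤ rieszWeight d z ξ := le_max_left _ _
  have h4 := fourierPower_nonneg hU hfin w.1 ξ
  nlinarith

/-- The energy deficit of an element of `H¹₀(U)` is controlled by its low frequencies. -/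
theorem sobolevH10_energy_le {d : ℕ} {U : Set (EuclideanSpace ℝ (Fin d))}
    (hU : MeasurableSet U) (hfin : volume U ≠ ⊤) (hb : Bornology.IsBounded U) (z : ℝ)
    {w : L2Scalar d × L2Field d} (hw : w ∈ sobolevH10 U) :
    z * ‖w.1‖ ^ 2 - ‖w.2‖ ^ 2 ≤ ∫ ξ, rieszWeight d z ξ * fourierPower hU hfin w.1 ξ := by
  obtain ⟨p, hp, hlim⟩ := mem_closure_iff_seq_limit.1 hw
  have h1 : Filter.Tendsto (fun m => (p m).1) Filter.atTop (nhds w.1) :=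
    (continuous_fst.tendsto w).comp hlim
  have h2 : Filter.Tendsto (fun m => (p m).2) Filter.atTop (nhds w.2) :=
    (continuous_snd.tendsto w).comp hlim
  obtain ⟨M, hM⟩ := h1.norm.bddAbove_range
  have hM' : ∀ m, ‖(p m).1‖ ≤ M := fun m => hM ⟨m, rfl⟩
  refine le_of_tendsto_of_tendsto' (((h1.norm.pow 2).const_mul z).sub (h2.norm.pow 2)) ?_
    fun m => testPairs_energy_le hU hfin hb z (hp m)
  -- The truncated weight is integrable and the Fourier power is at most |U|M² along the sequence,
  -- so the right side passes to the limit under L² convergence of the functions alone.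
  refine tendsto_integral_of_dominated_convergence
    (fun ξ => rieszWeight d z ξ * (volume.real U * M ^ 2)) (fun m => ?_)
    ((integrable_rieszWeight d z).mul_const _) (fun m => ?_) ?_
  · exact (integrable_rieszWeight_mul_fourierPower hU hfin hb z _).aestronglyMeasurable
  · refine Filter.Eventually.of_forall fun ξ => ?_
    rw [Real.norm_of_nonneg (mul_nonneg (rieszWeight_nonneg ξ) (fourierPower_nonneg ..))]
    refine mul_le_mul_of_nonneg_left ((fourierPower_le ..).trans ?_) (rieszWeight_nonneg ξ)
    have := hM' m
    gcongr
  · refine Filter.Eventually.of_forall fun ξ => Filter.Tendsto.const_mul _ ?_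
    unfold fourierPower
    exact ((tendsto_const_nhds.inner h1).pow 2).add ((tendsto_const_nhds.inner h1).pow 2)

/-- Polar coordinates. The radial integral stops at a = √z/(2π), where the weight vanishes, and
equals z a^d (1/d - 1/(d + 2)). -/
theorem integral_rieszWeight {d : ℕ} (hd : 0 < d) {z : ℝ} (hz : 0 ≤ z) :
    ∫ ξ, rieszWeight d z ξ = 2 / ((d : ℝ) + 2) * unitBallVolume d / (2 * Real.pi) ^ d *
      (z * √z ^ d) := by
  have hpi := Real.pi_pos
  have : Nonempty (Fin d) := ⟨⟨0, hd⟩⟩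
  have h := integral_fun_norm_addHaar (volume : Measure (EuclideanSpace ℝ (Fin d)))
    (fun r : ℝ => max (z - 4 * Real.pi ^ 2 * r ^ 2) 0)
  simp only [finrank_euclideanSpace, Fintype.card_fin, smul_eq_mul, nsmul_eq_mul] at h
  unfold rieszWeight unitBallVolume
  rw [h]
  set a := √z / (2 * Real.pi) with ha
  have ha0 : 0 ≤ a := by positivity
  have hza : z = 4 * Real.pi ^ 2 * a ^ 2 := by
    rw [ha, div_pow, Real.sq_sqrt hz]; field_simp; ring
  have hInt : ∫ y in Set.Ioi (0 : ℝ), y ^ (d - 1) * max (z - 4 * Real.pi ^ 2 * y ^ 2) 0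
      = ∫ y in (0 : ℝ)..a, (z * y ^ (d - 1) - 4 * Real.pi ^ 2 * y ^ (d + 1)) := by
    rw [intervalIntegral.integral_of_le ha0,
      ← Set.inter_eq_right.2 (Set.Ioc_subset_Ioi_self : Set.Ioc 0 a ⊆ Set.Ioi 0),
      ← setIntegral_indicator measurableSet_Ioc]
    refine setIntegral_congr_fun measurableSet_Ioi fun y hy => ?_
    have hy0 : 0 < y := hy
    have hyd : y ^ (d + 1) = y ^ (d - 1) * y ^ 2 := by rw [← pow_add]; congr 1; omega
    by_cases hya : y ≤ a
    · rw [Set.indicator_of_mem (show y ∈ Set.Ioc 0 a from ⟨hy0, hya⟩)]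
      rw [max_eq_left, hyd]
      · ring
      · rw [hza, ← mul_sub]
        have : y ^ 2 ≤ a ^ 2 := by gcongr
        have : 0 ≤ a ^ 2 - y ^ 2 := by linarith
        positivity
    · rw [Set.indicator_of_notMem (fun h => hya h.2)]
      rw [max_eq_right, mul_zero]
      rw [hza, ← mul_sub]
      have : a ^ 2 ≤ y ^ 2 := by
        have := (not_le.1 hya).le
        gcongr
      have : a ^ 2 - y ^ 2 ≤ 0 := by linarith
      exact mul_nonpos_of_nonneg_of_nonpos (by positivity) this
  rw [hInt, intervalIntegral.integral_sub
    (Continuous.intervalIntegrable (by fun_prop) _ _)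
    (Continuous.intervalIntegrable (by fun_prop) _ _), intervalIntegral.integral_const_mul,
    intervalIntegral.integral_const_mul, integral_pow, integral_pow, Nat.sub_add_cancel hd,
    show √z ^ d = a ^ d * (2 * Real.pi) ^ d by rw [ha, div_pow]; field_simp]
  have hd' : (0 : ℝ) < d := by exact_mod_cast hd
  have hcast : ((d - 1 : ℕ) : ℝ) + 1 = d := by exact_mod_cast Nat.sub_add_cancel hd
  rw [hcast, zero_pow (by omega), zero_pow (by omega), hza]
  push_cast
  field_simp
  ring

/-- Berezin's inequality for the eigenvalue sums of an `L²`-orthonormal family in `H¹₀(U)`. -/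
theorem berezin_inequality {d : ℕ} (hd : 0 < d) {U : Set (EuclideanSpace ℝ (Fin d))}
    (hU : IsOpen U) (hb : Bornology.IsBounded U) {z : ℝ} (hz : 0 ≤ z)
    {ι : Type*} [Fintype ι] {w : ι → L2Scalar d × L2Field d}
    (hw : ∀ i, w i ∈ sobolevH10 U) (ho : Orthonormal ℝ fun i => (w i).1) :
    ∑ i, (z - ‖(w i).2‖ ^ 2) ≤
      volume.real U * (2 / ((d : ℝ) + 2) * unitBallVolume d / (2 * Real.pi) ^ d * (z * √z ^ d)) := by
  have hfin : volume U ≠ ⊤ := hb.measure_lt_top.ne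
  have hm := hU.measurableSet
  calc ∑ i, (z - ‖(w i).2‖ ^ 2)
      ≤ ∑ i, ∫ ξ, rieszWeight d z ξ * fourierPower hm hfin (w i).1 ξ := by
        refine Finset.sum_le_sum fun i _ => ?_
        have := sobolevH10_energy_le hm hfin hb z (hw i)
        rwa [ho.1 i, one_pow, mul_one] at this
    _ = ∫ ξ, ∑ i, rieszWeight d z ξ * fourierPower hm hfin (w i).1 ξ :=
        (integral_finsetSum _ fun i _ =>
          integrable_rieszWeight_mul_fourierPower hm hfin hb z _).symm
    -- Bessel's inequality, pointwise in ξ.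
    _ ≤ ∫ ξ, volume.real U * rieszWeight d z ξ := by
        refine integral_mono (integrable_finsetSum _ fun i _ =>
          integrable_rieszWeight_mul_fourierPower hm hfin hb z _)
          ((integrable_rieszWeight d z).const_mul _) fun ξ => ?_
        simp only
        rw [← Finset.mul_sum, mul_comm]
        exact mul_le_mul_of_nonneg_right (sum_fourierPower_le hm hfin ho ξ) (rieszWeight_nonneg ξ)
    _ = _ := by rw [integral_const_mul, integral_rieszWeight hd hz]

/-! ### The Hilbert space H¹₀, Rellich compactness and completeness of eigenfunctions -/

theorem gradient_add' {F : Type*} [NormedAddCommGroup F] [InnerProductSpace ℝ F] [CompleteSpace F]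
    {f g : F → ℝ} (hf : Differentiable ℝ f) (hg : Differentiable ℝ g) :
    gradient (f + g) = gradient f + gradient g := by
  ext1 x
  simp only [gradient, Pi.add_apply, fderiv_add (hf x) (hg x), map_add]

theorem gradient_const_smul' {F : Type*} [NormedAddCommGroup F] [InnerProductSpace ℝ F]
    [CompleteSpace F] {f : F → ℝ} (hf : Differentiable ℝ f) (c : ℝ) :
    gradient (c • f) = c • gradient f := by
  ext1 x
  simp only [gradient, Pi.smul_apply, fderiv_const_smul (hf x), map_smul]

/-- The test pairs form a linear subspace. -/
def testSubmodule {d : ℕ} (U : Set (EuclideanSpace ℝ (Fin d))) :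
    Submodule ℝ (L2Scalar d × L2Field d) where
  carrier := testPairs U
  zero_mem' := by
    refine ⟨0, contDiff_const, HasCompactSupport.zero, by simp [tsupport], ?_, ?_⟩
    · exact Lp.coeFn_zero _ _ _
    · refine (Lp.coeFn_zero _ _ _).trans (Filter.Eventually.of_forall fun x => ?_)
      simp [gradient]
  add_mem' := by
    rintro p q ⟨φ, hφ, hc, hs, h1, h2⟩ ⟨ψ, hψ, hc', hs', h1', h2'⟩
    refine ⟨φ + ψ, hφ.add hψ, hc.add hc', (tsupport_add _ _).trans (Set.union_subset hs hs'),
      ?_, ?_⟩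
    · filter_upwards [Lp.coeFn_add p.1 q.1, h1, h1'] with x e1 e2 e3
      simp only [Prod.fst_add, e1, Pi.add_apply, e2, e3]
    · rw [gradient_add' (hφ.differentiable (by simp)) (hψ.differentiable (by simp))]
      filter_upwards [Lp.coeFn_add p.2 q.2, h2, h2'] with x e1 e2 e3
      simp only [Prod.snd_add, e1, Pi.add_apply, e2, e3]
  smul_mem' := by
    rintro c p ⟨φ, hφ, hc, hs, h1, h2⟩
    refine ⟨c • φ, hφ.const_smul c, hc.smul_left (f := fun _ => c),
      (tsupport_smul_subset_right (fun _ => c) φ).trans hs, ?_, ?_⟩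
    · filter_upwards [Lp.coeFn_smul c p.1, h1] with x e1 e2
      simp only [Prod.smul_fst, e1, Pi.smul_apply, e2]
    · rw [gradient_const_smul' (hφ.differentiable (by simp))]
      filter_upwards [Lp.coeFn_smul c p.2, h2] with x e1 e2
      simp only [Prod.smul_snd, e1, Pi.smul_apply, e2]

/-- `H¹₀(U)` as a subspace of the Hilbert space `L² ⊕ L²`. -/
def sobolevSubmodule {d : ℕ} (U : Set (EuclideanSpace ℝ (Fin d))) :
    Submodule ℝ (WithLp 2 (L2Scalar d × L2Field d)) :=
  (testSubmodule U).topologicalClosure.comap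
    (WithLp.linearEquiv 2 ℝ (L2Scalar d × L2Field d)).toLinearMap

theorem mem_sobolevSubmodule {d : ℕ} {U : Set (EuclideanSpace ℝ (Fin d))}
    {x : WithLp 2 (L2Scalar d × L2Field d)} :
    x ∈ sobolevSubmodule U ↔ x.ofLp ∈ sobolevH10 U := Iff.rfl

theorem isClosed_sobolevSubmodule {d : ℕ} (U : Set (EuclideanSpace ℝ (Fin d))) :
    IsClosed (sobolevSubmodule U : Set (WithLp 2 (L2Scalar d × L2Field d))) :=
  (testSubmodule U).isClosed_topologicalClosure.preimage
    (WithLp.prod_continuous_ofLp 2 (L2Scalar d) (L2Field d))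

instance {d : ℕ} (U : Set (EuclideanSpace ℝ (Fin d))) : CompleteSpace (sobolevSubmodule U) :=
  (isClosed_sobolevSubmodule U).completeSpace_coe

/-- The embedding `H¹₀(U) → L²`. -/
def sobolevEmbedding {d : ℕ} (U : Set (EuclideanSpace ℝ (Fin d))) :
    sobolevSubmodule U →L[ℝ] L2Scalar d :=
  (WithLp.fstL 2 ℝ (L2Scalar d) (L2Field d)).comp (sobolevSubmodule U).subtypeL

theorem sobolevEmbedding_apply {d : ℕ} {U : Set (EuclideanSpace ℝ (Fin d))}
    (x : sobolevSubmodule U) : sobolevEmbedding U x = x.1.ofLp.1 := rfl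

theorem norm_sq_sobolevSubmodule {d : ℕ} {U : Set (EuclideanSpace ℝ (Fin d))}
    (x : sobolevSubmodule U) : ‖x‖ ^ 2 = ‖x.1.ofLp.1‖ ^ 2 + ‖x.1.ofLp.2‖ ^ 2 := by
  rw [← Submodule.norm_coe, WithLp.prod_norm_sq_eq_of_L2]
  rfl

/-- Finitely many linear conditions make the `L²` norm small compared with the `H¹` norm. -/
theorem exists_finite_test_norm_le {d : ℕ} {U : Set (EuclideanSpace ℝ (Fin d))}
    (hU : MeasurableSet U) (hb : Bornology.IsBounded U) {ε : ℝ} (hε : 0 < ε) :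
    ∃ t : Set (L2Scalar d), t.Finite ∧ ∀ w ∈ sobolevH10 U, (∀ y ∈ t, inner ℝ y w.1 = 0) →
      ‖w.1‖ ^ 2 ≤ ε * (‖w.1‖ ^ 2 + ‖w.2‖ ^ 2) := by
  have hfin : volume U ≠ ⊤ := hb.measure_lt_top.ne
  -- At this level the energy bound reads ‖u‖²/ε ≤ ‖∇u‖² + (low-frequency integral); it remains to
  -- make the last term at most ‖u‖².
  set z : ℝ := 1 / ε with hz
  have hz0 : 0 < z := by positivity
  set I : ℝ := ∫ ξ, rieszWeight d z ξ with hI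
  have hI0 : 0 ≤ I := integral_nonneg fun ξ => rieszWeight_nonneg ξ
  obtain ⟨δ, hδ0, hδ⟩ : ∃ δ : ℝ, 0 < δ ∧ 2 * δ ^ 2 * I ≤ 1 := by
    refine ⟨√(1 / (2 * (I + 1))), by positivity, ?_⟩
    rw [Real.sq_sqrt (by positivity)]
    field_simp
    linarith
  -- The waves with frequency in the support ball form a compact set in L². A function orthogonal to
  -- a finite δ-net of it has all its low-frequency coefficients bounded by δ‖u‖.
  have hnet : ∀ θ : ℝ, ∃ t : Set (L2Scalar d), t.Finite ∧
      ∀ ξ ∈ Metric.closedBall (0 : EuclideanSpace ℝ (Fin d)) (√|z|),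
        ∃ y ∈ t, ‖planeWave hU hfin θ ξ - y‖ < δ := by
    intro θ
    have hK := ((isCompact_closedBall (0 : EuclideanSpace ℝ (Fin d)) (√|z|)).image
      (continuous_planeWave hU hfin hb θ)).totallyBounded
    obtain ⟨t, ht, hcov⟩ := Metric.totallyBounded_iff.1 hK δ hδ0
    refine ⟨t, ht, fun ξ hξ => ?_⟩
    obtain ⟨y, hy, hxy⟩ := Set.mem_iUnion₂.1 (hcov ⟨ξ, hξ, rfl⟩)
    exact ⟨y, hy, by rwa [← dist_eq_norm]⟩
  obtain ⟨t₀, ht₀, hc₀⟩ := hnet 0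
  obtain ⟨t₁, ht₁, hc₁⟩ := hnet (Real.pi / 2)
  refine ⟨t₀ ∪ t₁, ht₀.union ht₁, fun w hw hort => ?_⟩
  have hsq : ∀ θ ξ y, y ∈ t₀ ∪ t₁ → ‖planeWave hU hfin θ ξ - y‖ < δ →
      inner ℝ (planeWave hU hfin θ ξ) w.1 ^ 2 ≤ δ ^ 2 * ‖w.1‖ ^ 2 := by
    intro θ ξ y hy hlt
    have h1 : inner ℝ (planeWave hU hfin θ ξ) w.1 = inner ℝ (planeWave hU hfin θ ξ - y) w.1 := by
      rw [inner_sub_left, hort y hy, sub_zero]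
    rw [h1, ← mul_pow, ← sq_abs]
    have h2 := abs_real_inner_le_norm (planeWave hU hfin θ ξ - y) w.1
    have h3 := h2.trans (mul_le_mul_of_nonneg_right hlt.le (norm_nonneg _))
    gcongr
  have hen := sobolevH10_energy_le hU hfin hb z hw
  have hInt : ∫ ξ, rieszWeight d z ξ * fourierPower hU hfin w.1 ξ ≤ ‖w.1‖ ^ 2 := by
    calc ∫ ξ, rieszWeight d z ξ * fourierPower hU hfin w.1 ξ
        ≤ ∫ ξ, rieszWeight d z ξ * (2 * δ ^ 2 * ‖w.1‖ ^ 2) := by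
          refine integral_mono (integrable_rieszWeight_mul_fourierPower hU hfin hb z _)
            ((integrable_rieszWeight d z).mul_const _) fun ξ => ?_
          by_cases hξ : ξ ∈ Metric.closedBall (0 : EuclideanSpace ℝ (Fin d)) (√|z|)
          · refine mul_le_mul_of_nonneg_left ?_ (rieszWeight_nonneg ξ)
            obtain ⟨y, hy, hlt⟩ := hc₀ ξ hξ
            obtain ⟨y', hy', hlt'⟩ := hc₁ ξ hξ
            have := hsq 0 ξ y (Or.inl hy) hlt
            have := hsq (Real.pi / 2) ξ y' (Or.inr hy') hlt'
            unfold fourierPower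
            linarith
          · have : rieszWeight d z ξ = 0 := by
              rw [mem_closedBall_zero_iff, not_le] at hξ
              exact rieszWeight_eq_zero (Real.lt_sq_of_sqrt_lt hξ)
            simp [this]
      _ = 2 * δ ^ 2 * I * ‖w.1‖ ^ 2 := by rw [integral_mul_const]; ring
      _ ≤ 1 * ‖w.1‖ ^ 2 := by gcongr
      _ = ‖w.1‖ ^ 2 := one_mul _
  have h4 : z * ‖w.1‖ ^ 2 ≤ ‖w.1‖ ^ 2 + ‖w.2‖ ^ 2 := by linarith
  have h5 := mul_le_mul_of_nonneg_left h4 hε.le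
  rwa [← mul_assoc, hz, mul_one_div_cancel hε.ne', one_mul] at h5

/-- An operator between Hilbert spaces that is small on subspaces of finite codimension is
compact. -/
theorem isCompactOperator_of_forall_exists_finite {H F : Type*} [NormedAddCommGroup H]
    [InnerProductSpace ℝ H] [CompleteSpace H] [NormedAddCommGroup F] [InnerProductSpace ℝ F]
    [CompleteSpace F] (J : H →L[ℝ] F)
    (hJ : ∀ ε > 0, ∃ t : Set F, t.Finite ∧ ∀ x, (∀ y ∈ t, inner ℝ y (J x) = 0) →
      ‖J x‖ ^ 2 ≤ ε * ‖x‖ ^ 2) : IsCompactOperator J := by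
  have hcl : IsClosed {f : H →L[ℝ] F | IsCompactOperator f} := isClosed_setOfPred_isCompactOperator
  have hmem : J ∈ closure {f : H →L[ℝ] F | IsCompactOperator f} := by
    rw [Metric.mem_closure_iff]
    intro ε hε
    obtain ⟨t, ht, htest⟩ := hJ ((ε / 2) ^ 2) (by positivity)
    -- Vectors orthogonal to S satisfy the finitely many test conditions, so J differs from the
    -- finite-rank operator J ∘ P_S by norm at most ε/2; compact operators are closed in norm.
    set S := Submodule.span ℝ (J.adjoint '' t) with hS
    have : FiniteDimensional ℝ S := FiniteDimensional.span_of_finite ℝ (ht.image _)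
    refine ⟨J.comp S.starProjection, ?_, ?_⟩
    · have := FiniteDimensional.proper_real S
      have h1 : IsCompactOperator S.orthogonalProjectionOnto :=
        isCompactOperator_of_locallyCompactSpace_dom S.orthogonalProjectionOnto
      exact h1.clm_comp (J.comp S.subtypeL)
    · rw [dist_eq_norm]
      refine lt_of_le_of_lt (ContinuousLinearMap.opNorm_le_bound _ (by positivity : 0 ≤ ε / 2)
        fun w => ?_) (half_lt_self hε)
      have hw' : w - S.starProjection w ∈ Sᗮ := Submodule.sub_starProjection_mem_orthogonal w
      have hle : ‖w - S.starProjection w‖ ≤ ‖w‖ := by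
        rw [← Submodule.starProjection_orthogonal_val]
        exact Sᗮ.norm_starProjection_apply_le w
      have h2 := htest (w - S.starProjection w) fun y hy => by
        rw [← ContinuousLinearMap.adjoint_inner_left]
        exact (Submodule.mem_orthogonal _ _).1 hw' _ (Submodule.subset_span ⟨y, hy, rfl⟩)
      rw [← mul_pow] at h2
      have h3 := abs_le_of_sq_le_sq h2 (by positivity)
      rw [abs_of_nonneg (norm_nonneg _)] at h3
      rw [show (J - J.comp S.starProjection) w = J (w - S.starProjection w) by simp]
      exact h3.trans (by gcongr)
  rwa [hcl.closure_eq] at hmem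

/-- **Rellich's theorem**: `H¹₀(U)` embeds compactly in `L²` when `U` is bounded. -/
theorem isCompactOperator_sobolevEmbedding {d : ℕ} {U : Set (EuclideanSpace ℝ (Fin d))}
    (hU : MeasurableSet U) (hb : Bornology.IsBounded U) :
    IsCompactOperator (sobolevEmbedding U) := by
  refine isCompactOperator_of_forall_exists_finite _ fun ε hε => ?_
  obtain ⟨t, ht, htest⟩ := exists_finite_test_norm_le hU hb hε
  refine ⟨t, ht, fun x hx => ?_⟩
  rw [norm_sq_sobolevSubmodule]
  exact htest x.1.ofLp x.2 hx

/-- The resolvent-type operator `J* J` on `H¹₀(U)`, where `J` is the embedding in `L²`. -/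
def sobolevGram {d : ℕ} (U : Set (EuclideanSpace ℝ (Fin d))) :
    sobolevSubmodule U →L[ℝ] sobolevSubmodule U :=
  (sobolevEmbedding U).adjoint.comp (sobolevEmbedding U)

theorem inner_sobolevGram {d : ℕ} {U : Set (EuclideanSpace ℝ (Fin d))}
    (x y : sobolevSubmodule U) :
    inner ℝ (sobolevGram U x) y = inner ℝ (x.1.ofLp.1) (y.1.ofLp.1) := by
  rw [sobolevGram, ContinuousLinearMap.comp_apply, ContinuousLinearMap.adjoint_inner_left]
  rfl

theorem isSymmetric_sobolevGram {d : ℕ} (U : Set (EuclideanSpace ℝ (Fin d))) :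
    (sobolevGram U).IsSymmetric := by
  intro x y
  rw [← real_inner_comm]
  change inner ℝ y (sobolevGram U x) = inner ℝ x (sobolevGram U y)
  rw [real_inner_comm, real_inner_comm _ x, inner_sobolevGram, inner_sobolevGram,
    real_inner_comm]

theorem inner_sobolevSubmodule {d : ℕ} {U : Set (EuclideanSpace ℝ (Fin d))}
    (x y : sobolevSubmodule U) : inner ℝ x y =
      inner ℝ x.1.ofLp.1 y.1.ofLp.1 + inner ℝ x.1.ofLp.2 y.1.ofLp.2 := by
  rw [Submodule.coe_inner, WithLp.prod_inner_apply]

theorem fst_eq_zero_of_sobolevGram_eq_zero {d : ℕ} {U : Set (EuclideanSpace ℝ (Fin d))}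
    {x : sobolevSubmodule U} (hx : sobolevGram U x = 0) : x.1.ofLp.1 = 0 := by
  rw [← inner_self_eq_zero (𝕜 := ℝ), ← inner_sobolevGram, hx, inner_zero_left]

/-- Paired with v, the relation J*Jx = κx reads ⟨u, v⟩ = κ(⟨u, v⟩ + ⟨∇u, ∇v⟩), whence the eigenvalue
1/κ - 1. -/
theorem isDirichletEigenfunction_of_sobolevGram_eq {d : ℕ} {U : Set (EuclideanSpace ℝ (Fin d))}
    {x : sobolevSubmodule U} (hx : x ≠ 0) {κ : ℝ} (hκ : κ ≠ 0) (h : sobolevGram U x = κ • x) :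
    IsDirichletEigenfunction U (1 / κ - 1) x.1.ofLp := by
  refine ⟨x.2, fun h0 => ?_, fun v hv => ?_⟩
  · have : sobolevGram U x = 0 := by
      rw [sobolevGram, ContinuousLinearMap.comp_apply, sobolevEmbedding_apply, h0, map_zero]
    rw [h] at this
    exact hx ((smul_eq_zero.1 this).resolve_left hκ)
  · have h1 := inner_sobolevGram x
      (⟨WithLp.toLp 2 v, mem_sobolevSubmodule.2 hv⟩ : sobolevSubmodule U)
    have h2 : ∀ y : sobolevSubmodule U, inner ℝ (κ • x) y = κ * inner ℝ x y :=
      fun y => real_inner_smul_left x y κ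
    rw [h, h2, inner_sobolevSubmodule] at h1
    rw [sub_mul, one_mul, ← h1]
    field_simp
    linarith

/-- Completeness of the Dirichlet eigenfunctions. -/
theorem inner_eq_zero_of_forall_eigenfunction {d : ℕ} {U : Set (EuclideanSpace ℝ (Fin d))}
    (hU : MeasurableSet U) (hb : Bornology.IsBounded U) {f : L2Scalar d}
    (hf : ∀ μ g, IsDirichletEigenfunction U μ g → inner ℝ g.1 f = 0)
    {w : L2Scalar d × L2Field d} (hw : w ∈ sobolevH10 U) : inner ℝ w.1 f = 0 := by
  have hcomp : IsCompactOperator (sobolevGram U) :=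
    (isCompactOperator_sobolevEmbedding hU hb).clm_comp (sobolevEmbedding U).adjoint
  have hbot := ContinuousLinearMap.orthogonalComplement_iSup_eigenspaces_eq_bot hcomp
    (isSymmetric_sobolevGram U)
  -- The eigenspaces of the compact symmetric operator J*J have dense sum. Orthogonality to all of
  -- them forces J*f = 0, that is, f is orthogonal to the range of J.
  have hmem : (sobolevEmbedding U).adjoint f ∈
      (⨆ κ, Module.End.eigenspace (sobolevGram U : Module.End ℝ (sobolevSubmodule U)) κ)ᗮ := by
    rw [← Submodule.iInf_orthogonal, Submodule.mem_iInf]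
    intro κ
    rw [Submodule.mem_orthogonal]
    intro x hx
    rw [Module.End.mem_eigenspace_iff] at hx
    change sobolevGram U x = κ • x at hx
    rw [ContinuousLinearMap.adjoint_inner_right, sobolevEmbedding_apply]
    by_cases hκ : κ = 0
    · rw [fst_eq_zero_of_sobolevGram_eq_zero (by rw [hx, hκ, zero_smul]), inner_zero_left]
    · by_cases hx0 : x = 0
      · simp [hx0]
      · exact hf _ _ (isDirichletEigenfunction_of_sobolevGram_eq hx0 hκ hx)
  rw [hbot, Submodule.mem_bot] at hmem
  have := ContinuousLinearMap.adjoint_inner_right (sobolevEmbedding U)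
    (⟨WithLp.toLp 2 w, mem_sobolevSubmodule.2 hw⟩ : sobolevSubmodule U) f
  rw [hmem, inner_zero_right] at this
  exact this.symm

/-! ### Existence of arbitrarily many eigenfunctions -/

theorem continuous_gradient {d : ℕ} {φ : EuclideanSpace ℝ (Fin d) → ℝ} (hφ : ContDiff ℝ ∞ φ) :
    Continuous (gradient φ) :=
  (LinearIsometryEquiv.continuous _).comp (hφ.continuous_fderiv (by simp))

theorem hasCompactSupport_gradient {d : ℕ} {φ : EuclideanSpace ℝ (Fin d) → ℝ}
    (hc : HasCompactSupport φ) : HasCompactSupport (gradient φ) :=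
  (hc.fderiv (𝕜 := ℝ)).comp_left (map_zero _)

theorem exists_testPair {d : ℕ} {U : Set (EuclideanSpace ℝ (Fin d))}
    {φ : EuclideanSpace ℝ (Fin d) → ℝ} (hφ : ContDiff ℝ ∞ φ) (hc : HasCompactSupport φ)
    (hs : tsupport φ ⊆ U) :
    ∃ p ∈ testPairs U, p.1 =ᵐ[volume] φ ∧ p.2 =ᵐ[volume] gradient φ := by
  have h1 : MemLp φ 2 (volume : Measure (EuclideanSpace ℝ (Fin d))) :=
    hφ.continuous.memLp_of_hasCompactSupport hc
  have h2 : MemLp (gradient φ) 2 (volume : Measure (EuclideanSpace ℝ (Fin d))) :=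
    (continuous_gradient hφ).memLp_of_hasCompactSupport (hasCompactSupport_gradient hc)
  exact ⟨(h1.toLp φ, h2.toLp _), ⟨φ, hφ, hc, hs, h1.coeFn_toLp, h2.coeFn_toLp⟩,
    h1.coeFn_toLp, h2.coeFn_toLp⟩

/-- Bump functions at k points of U with disjoint supports are nonzero and pairwise orthogonal. -/
theorem exists_linearIndependent_testPairs {d : ℕ} (hd : 0 < d)
    {U : Set (EuclideanSpace ℝ (Fin d))} (hU : IsOpen U) (hne : U.Nonempty) (k : ℕ) :
    ∃ p : Fin k → L2Scalar d × L2Field d, (∀ i, p i ∈ testPairs U) ∧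
      LinearIndependent ℝ fun i => (p i).1 := by
  have : Nonempty (Fin d) := ⟨⟨0, hd⟩⟩
  obtain ⟨x₀, hx₀⟩ := hne
  have hinf : U.Infinite := infinite_of_mem_nhds x₀ (hU.mem_nhds hx₀)
  obtain ⟨s, hsU, hcard⟩ := hinf.exists_subset_card_eq k
  obtain ⟨V, hV, hdisj⟩ := s.finite_toSet.t2_separation
  let e : Fin k ≃ s := (Finset.equivFinOfCardEq hcard).symm
  have hbump : ∀ i : Fin k, ∃ φ : EuclideanSpace ℝ (Fin d) → ℝ,
      tsupport φ ⊆ V (e i) ∩ U ∧ HasCompactSupport φ ∧ ContDiff ℝ ∞ φ ∧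
        Set.range φ ⊆ Set.Icc 0 1 ∧ φ (e i) = 1 := by
    intro i
    exact exists_contDiff_tsupport_subset
      (((hV _).2.inter hU).mem_nhds ⟨(hV _).1, hsU (e i).2⟩)
  choose φ hsupp hc hφ hrange hone using hbump
  choose p hp h1 h2 using fun i => exists_testPair (hφ i) (hc i)
    ((hsupp i).trans Set.inter_subset_right)
  refine ⟨p, hp, linearIndependent_of_ne_zero_of_inner_eq_zero (𝕜 := ℝ) (fun i h0 => ?_)
    fun i j hij => ?_⟩
  · have hz : φ i =ᵐ[volume] fun _ => (0 : ℝ) := by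
      refine (h1 i).symm.trans ?_
      rw [h0]
      exact Lp.coeFn_zero _ _ _
    have := (Continuous.ae_eq_iff_eq volume (hφ i).continuous continuous_const).1 hz
    have h := congrFun this (e i)
    rw [hone] at h
    exact one_ne_zero h
  · change inner ℝ (p i).1 (p j).1 = 0
    rw [L2.inner_def]
    refine integral_eq_zero_of_ae ?_
    filter_upwards [h1 i, h1 j] with x e1 e2
    rw [e1, e2]
    by_cases hx : x ∈ V (e i)
    · have hd' : Disjoint (V (e i)) (V (e j)) :=
        hdisj (e i).2 (e j).2 fun h => hij (e.injective (Subtype.ext h))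
      have : φ j x = 0 := image_eq_zero_of_notMem_tsupport fun h =>
        Set.disjoint_left.1 hd' hx (hsupp j h).1
      simp [this]
    · have : φ i x = 0 := image_eq_zero_of_notMem_tsupport fun h => hx (hsupp i h).1
      simp [this]

/-- A bounded nonempty open set has arbitrarily many independent Dirichlet eigenfunctions. -/
theorem exists_linearIndependent_eigenfunctions {d : ℕ} (hd : 0 < d)
    {U : Set (EuclideanSpace ℝ (Fin d))} (hU : IsOpen U) (hne : U.Nonempty)
    (hb : Bornology.IsBounded U) (k : ℕ) :
    ∃ (Λ : ℝ) (w : Fin k → L2Scalar d × L2Field d), LinearIndependent ℝ (fun i => (w i).1) ∧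
      ∀ i, ∃ μ ≤ Λ, IsDirichletEigenfunction U μ (w i) := by
  set G : Set (L2Scalar d) := {u | ∃ w : L2Scalar d × L2Field d, w.1 = u ∧
    ∃ μ, IsDirichletEigenfunction U μ w}
  obtain ⟨b, hbG, hspan, hli⟩ := exists_linearIndependent ℝ G
  by_cases hk : ∃ t : Finset (L2Scalar d), ↑t ⊆ b ∧ t.card = k
  · obtain ⟨t, htb, hcard⟩ := hk
    let e : Fin k ≃ t := (Finset.equivFinOfCardEq hcard).symm
    have hG : ∀ i : Fin k, ∃ w : L2Scalar d × L2Field d, w.1 = (e i : L2Scalar d) ∧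
        ∃ μ, IsDirichletEigenfunction U μ w := fun i => hbG (htb (e i).2)
    choose w hw μ hμ using hG
    obtain ⟨Λ, hΛ⟩ := (Set.finite_range μ).bddAbove
    refine ⟨Λ, w, ?_, fun i => ⟨μ i, hΛ ⟨i, rfl⟩, hμ i⟩⟩
    simp only [hw]
    exact hli.comp (fun i => ⟨e i, htb (e i).2⟩) fun i j h =>
      e.injective (Subtype.ext (congrArg (fun z : b => (z : L2Scalar d)) h))
  -- Otherwise the eigenfunctions span a space F of dimension less than k. Completeness puts every
  -- H¹₀ function in F⊥⊥ = F, against the existence of k independent test functions.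
  · exfalso
    have hfin : b.Finite := by
      by_contra hinf
      exact hk (Set.Infinite.exists_subset_card_eq hinf k)
    have hlt : hfin.toFinset.card < k := by
      by_contra hle
      obtain ⟨t, ht, hc⟩ := Finset.exists_subset_card_eq (not_lt.1 hle)
      exact hk ⟨t, fun x hx => hfin.mem_toFinset.1 (ht hx), hc⟩
    set F := Submodule.span ℝ b
    have hFfin : FiniteDimensional ℝ F := FiniteDimensional.span_of_finite ℝ hfin
    have hsub : ∀ w ∈ sobolevH10 U, w.1 ∈ F := by
      intro w hw
      rw [← Submodule.orthogonal_orthogonal F, Submodule.mem_orthogonal]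
      intro f hf
      rw [real_inner_comm]
      refine inner_eq_zero_of_forall_eigenfunction hU.measurableSet hb (fun μ g hg => ?_) hw
      refine (Submodule.mem_orthogonal _ _).1 hf _ ?_
      rw [show F = _ from hspan]
      exact Submodule.subset_span ⟨g, rfl, μ, hg⟩
    obtain ⟨p, hp, hpl⟩ := exists_linearIndependent_testPairs hd hU hne k
    have hli' : LinearIndependent ℝ fun i => (⟨(p i).1, hsub _ (subset_closure (hp i))⟩ : F) :=
      LinearIndependent.of_comp F.subtype hpl
    have h1 := hli'.fintype_card_le_finrank
    have h2 := finrank_span_finset_le_card (R := ℝ) hfin.toFinset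
    rw [Set.Finite.coe_toFinset] at h2
    rw [Fintype.card_fin] at h1
    exact absurd (h1.trans h2) (not_le.2 hlt)

/-! ### Tensor products over the splitting of the last coordinate -/

/-- The splitting `ℝ^(n+1) ≃ ℝ^n × ℝ` off the last coordinate. -/
def splitLast (n : ℕ) : EuclideanSpace ℝ (Fin (n + 1)) ≃L[ℝ] EuclideanSpace ℝ (Fin n) × ℝ :=
  LinearEquiv.toContinuousLinearEquiv
    { toFun := fun y => (WithLp.toLp 2 fun i : Fin n => y i.castSucc, y (Fin.last n))
      map_add' := fun x y => rfl
      map_smul' := fun c x => rfl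
      invFun := fun p => WithLp.toLp 2 (Fin.snoc (α := fun _ => ℝ) p.1.ofLp p.2)
      left_inv := fun y => by
        ext i
        refine Fin.lastCases ?_ (fun j => ?_) i <;> simp
      right_inv := fun p => by
        refine Prod.ext ?_ ?_
        · ext j; simp
        · simp }

theorem splitLast_fst {n : ℕ} (y : EuclideanSpace ℝ (Fin (n + 1))) :
    (splitLast n y).1 = WithLp.toLp 2 fun i : Fin n => y i.castSucc := rfl

theorem splitLast_snd {n : ℕ} (y : EuclideanSpace ℝ (Fin (n + 1))) :
    (splitLast n y).2 = y (Fin.last n) := rfl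

theorem inner_eq_splitLast {n : ℕ} (x y : EuclideanSpace ℝ (Fin (n + 1))) :
    inner ℝ x y = inner ℝ (splitLast n x).1 (splitLast n y).1
      + (splitLast n x).2 * (splitLast n y).2 := by
  rw [splitLast_fst, splitLast_fst, splitLast_snd, splitLast_snd, PiLp.inner_apply,
    PiLp.inner_apply, Fin.sum_univ_castSucc]
  simp [mul_comm]

theorem measurePreserving_splitLast (n : ℕ) :
    MeasurePreserving (splitLast n) volume (volume.prod volume) := by
  have h2 := volume_preserving_piFinSuccAbove (fun _ : Fin (n + 1) => ℝ) (Fin.last n)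
  have h3 : MeasurePreserving (Prod.swap : ℝ × (Fin n → ℝ) → (Fin n → ℝ) × ℝ)
    (volume.prod volume) (volume.prod volume) := Measure.measurePreserving_swap
  have h4 := (PiLp.volume_preserving_toLp (Fin n)).prod
    (MeasurePreserving.id (volume : Measure ℝ))
  have h5 := ((h4.comp h3).comp h2).comp (PiLp.volume_preserving_ofLp (Fin (n + 1)))
  have hf : ⇑(splitLast n) = ((Prod.map (WithLp.toLp 2) id ∘ Prod.swap) ∘
      (MeasurableEquiv.piFinSuccAbove (fun _ => ℝ) (Fin.last n))) ∘ WithLp.ofLp := by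
    refine funext fun y => Prod.ext ?_ rfl
    rw [splitLast_fst]
    ext i
    simp [MeasurableEquiv.piFinSuccAbove, Fin.insertNthEquiv, Fin.init]
  rw [hf]
  exact h5

theorem measurableEmbedding_splitLast (n : ℕ) : MeasurableEmbedding (splitLast n) :=
  (splitLast n).toHomeomorph.measurableEmbedding

theorem memLp_prod_smul {n : ℕ} {E : Type*} [NormedAddCommGroup E] [NormedSpace ℝ E]
    (v : Lp E 2 (volume : Measure (EuclideanSpace ℝ (Fin n))))
    (η : Lp ℝ 2 (volume : Measure ℝ)) :
    MemLp (fun p : EuclideanSpace ℝ (Fin n) × ℝ => η p.2 • v p.1) 2 (volume.prod volume) := by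
  have hm : AEStronglyMeasurable (fun p : EuclideanSpace ℝ (Fin n) × ℝ => η p.2 • v p.1)
      (volume.prod volume) :=
    (Lp.aestronglyMeasurable η).comp_snd.smul (Lp.aestronglyMeasurable v).comp_fst
  rw [← memLp_norm_iff hm, memLp_two_iff_integrable_sq hm.norm]
  have h1 := ((Lp.memLp v).integrable_norm_pow (by norm_num : (2 : ℕ) ≠ 0)).mul_prod
    ((Lp.memLp η).integrable_norm_pow (by norm_num : (2 : ℕ) ≠ 0))
  refine h1.congr (Filter.Eventually.of_forall fun p => ?_)
  simp only [norm_smul, mul_pow, mul_comm]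

theorem memLp_tensor {n : ℕ} {E : Type*} [NormedAddCommGroup E] [NormedSpace ℝ E]
    (v : Lp E 2 (volume : Measure (EuclideanSpace ℝ (Fin n))))
    (η : Lp ℝ 2 (volume : Measure ℝ)) :
    MemLp (fun y => η (splitLast n y).2 • v (splitLast n y).1) 2 volume :=
  (memLp_prod_smul v η).comp_measurePreserving (measurePreserving_splitLast n)

/-- The tensor product `v(x) η(t)` of `L²` functions. -/
def tensorLp {n : ℕ} {E : Type*} [NormedAddCommGroup E] [NormedSpace ℝ E]
    (v : Lp E 2 (volume : Measure (EuclideanSpace ℝ (Fin n)))) (η : Lp ℝ 2 (volume : Measure ℝ)) :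
    Lp E 2 (volume : Measure (EuclideanSpace ℝ (Fin (n + 1)))) :=
  (memLp_tensor v η).toLp _

theorem coeFn_tensorLp {n : ℕ} {E : Type*} [NormedAddCommGroup E] [NormedSpace ℝ E]
    (v : Lp E 2 (volume : Measure (EuclideanSpace ℝ (Fin n))))
    (η : Lp ℝ 2 (volume : Measure ℝ)) :
    tensorLp v η =ᵐ[volume] fun y => η (splitLast n y).2 • v (splitLast n y).1 :=
  MemLp.coeFn_toLp _

theorem ae_splitLast_fst {n : ℕ} {P : EuclideanSpace ℝ (Fin n) → Prop}
    (h : ∀ᵐ x ∂(volume : Measure (EuclideanSpace ℝ (Fin n))), P x) :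
    ∀ᵐ y ∂(volume : Measure (EuclideanSpace ℝ (Fin (n + 1)))), P (splitLast n y).1 :=
  (Measure.quasiMeasurePreserving_fst.comp
    (measurePreserving_splitLast n).quasiMeasurePreserving).ae h

theorem ae_splitLast_snd {n : ℕ} {P : ℝ → Prop} (h : ∀ᵐ t ∂(volume : Measure ℝ), P t) :
    ∀ᵐ y ∂(volume : Measure (EuclideanSpace ℝ (Fin (n + 1)))), P (splitLast n y).2 :=
  (Measure.quasiMeasurePreserving_snd.comp
    (measurePreserving_splitLast n).quasiMeasurePreserving).ae h

/-- By Fubini. The resulting boundedness of the bilinear map lets products of test pairs pass to the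
closures defining H¹₀. -/
theorem norm_tensorLp {n : ℕ} {E : Type*} [NormedAddCommGroup E] [InnerProductSpace ℝ E]
    (v : Lp E 2 (volume : Measure (EuclideanSpace ℝ (Fin n)))) (η : Lp ℝ 2 (volume : Measure ℝ)) :
    ‖tensorLp v η‖ = ‖v‖ * ‖η‖ := by
  have h : ‖tensorLp v η‖ ^ 2 = (‖v‖ * ‖η‖) ^ 2 := by
    rw [mul_pow, norm_sq_eq_integral, norm_sq_eq_integral, norm_sq_eq_integral,
      ← integral_prod_mul, ← (measurePreserving_splitLast n).integral_comp
        (measurableEmbedding_splitLast n)]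
    refine integral_congr_ae ?_
    filter_upwards [coeFn_tensorLp v η] with y hy
    rw [hy, norm_smul, mul_pow, mul_comm]
  exact (pow_left_inj₀ (norm_nonneg _) (by positivity) (by norm_num)).1 h

/-- The tensor product of `L²` functions as a continuous bilinear map. -/
def tensorL (n : ℕ) (E : Type*) [NormedAddCommGroup E] [InnerProductSpace ℝ E] :
    Lp E 2 (volume : Measure (EuclideanSpace ℝ (Fin n))) →L[ℝ] Lp ℝ 2 (volume : Measure ℝ) →L[ℝ]
      Lp E 2 (volume : Measure (EuclideanSpace ℝ (Fin (n + 1)))) :=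
  LinearMap.mkContinuous₂ (LinearMap.mk₂ ℝ tensorLp
    (fun v v' η => by
      refine Lp.ext ?_
      filter_upwards [coeFn_tensorLp (v + v') η, coeFn_tensorLp v η, coeFn_tensorLp v' η,
        Lp.coeFn_add (tensorLp v η) (tensorLp v' η), ae_splitLast_fst (Lp.coeFn_add v v')]
        with y h1 h2 h3 h4 h5
      rw [h1, h4, Pi.add_apply, h2, h3, h5, Pi.add_apply, smul_add])
    (fun c v η => by
      refine Lp.ext ?_
      filter_upwards [coeFn_tensorLp (c • v) η, coeFn_tensorLp v η,
        Lp.coeFn_smul c (tensorLp v η), ae_splitLast_fst (Lp.coeFn_smul c v)] with y h1 h2 h3 h4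
      rw [h1, h3, Pi.smul_apply, h2, h4, Pi.smul_apply, smul_comm])
    (fun v η η' => by
      refine Lp.ext ?_
      filter_upwards [coeFn_tensorLp v (η + η'), coeFn_tensorLp v η, coeFn_tensorLp v η',
        Lp.coeFn_add (tensorLp v η) (tensorLp v η'), ae_splitLast_snd (Lp.coeFn_add η η')]
        with y h1 h2 h3 h4 h5
      rw [h1, h4, Pi.add_apply, h2, h3, h5, Pi.add_apply, add_smul])
    (fun c v η => by
      refine Lp.ext ?_
      filter_upwards [coeFn_tensorLp v (c • η), coeFn_tensorLp v η,
        Lp.coeFn_smul c (tensorLp v η), ae_splitLast_snd (Lp.coeFn_smul c η)] with y h1 h2 h3 h4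
      rw [h1, h3, Pi.smul_apply, h2, h4, Pi.smul_apply, smul_assoc]))
    1 (fun v η => by
      rw [LinearMap.mk₂_apply, norm_tensorLp, one_mul])

theorem tensorL_apply {n : ℕ} {E : Type*} [NormedAddCommGroup E] [InnerProductSpace ℝ E]
    (v : Lp E 2 (volume : Measure (EuclideanSpace ℝ (Fin n)))) (η : Lp ℝ 2 (volume : Measure ℝ)) :
    tensorL n E v η = tensorLp v η := rfl

/-- The inclusion `ℝ^n → ℝ^(n+1)` with last coordinate zero. -/
def inclHorizontal (n : ℕ) : EuclideanSpace ℝ (Fin n) →L[ℝ] EuclideanSpace ℝ (Fin (n + 1)) :=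
  ((splitLast n).symm : _ →L[ℝ] EuclideanSpace ℝ (Fin (n + 1))).comp
    (ContinuousLinearMap.inl ℝ (EuclideanSpace ℝ (Fin n)) ℝ)

/-- The inclusion of the last coordinate axis. -/
def inclVertical (n : ℕ) : ℝ →L[ℝ] EuclideanSpace ℝ (Fin (n + 1)) :=
  ((splitLast n).symm : _ →L[ℝ] EuclideanSpace ℝ (Fin (n + 1))).comp
    (ContinuousLinearMap.inr ℝ (EuclideanSpace ℝ (Fin n)) ℝ)

theorem inner_inclHorizontal {n : ℕ} (y : EuclideanSpace ℝ (Fin (n + 1)))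
    (x : EuclideanSpace ℝ (Fin n)) :
    inner ℝ y (inclHorizontal n x) = inner ℝ (splitLast n y).1 x := by
  rw [inner_eq_splitLast]; simp [inclHorizontal]

theorem inner_inclVertical {n : ℕ} (y : EuclideanSpace ℝ (Fin (n + 1))) (t : ℝ) :
    inner ℝ y (inclVertical n t) = (splitLast n y).2 * t := by
  rw [inner_eq_splitLast]; simp [inclVertical]

theorem splitLast_symm_apply {n : ℕ} (x : EuclideanSpace ℝ (Fin n)) (t : ℝ) :
    (splitLast n).symm (x, t) = inclHorizontal n x + inclVertical n t := by
  simp [inclHorizontal, inclVertical, ← map_add]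

/-- The product `(v η, ∇(v η))` of the pairs `(v, ∇v)` on `ℝ^n` and `(η, η')` on `ℝ`. -/
def sobolevTensor {n : ℕ} (p : L2Scalar n × L2Field n)
    (q : Lp ℝ 2 (volume : Measure ℝ) × Lp ℝ 2 (volume : Measure ℝ)) :
    L2Scalar (n + 1) × L2Field (n + 1) :=
  (tensorL n ℝ p.1 q.1, (inclHorizontal n).compLpL 2 volume (tensorL n _ p.2 q.1) +
    (inclVertical n).compLpL 2 volume (tensorL n ℝ p.1 q.2))

theorem continuous_sobolevTensor {n : ℕ} :
    Continuous (Function.uncurry (sobolevTensor (n := n))) := by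
  unfold sobolevTensor Function.uncurry
  fun_prop

theorem coeFn_sobolevTensor_snd {n : ℕ} (p : L2Scalar n × L2Field n)
    (q : Lp ℝ 2 (volume : Measure ℝ) × Lp ℝ 2 (volume : Measure ℝ)) :
    (sobolevTensor p q).2 =ᵐ[volume] fun y =>
      inclHorizontal n (q.1 (splitLast n y).2 • p.2 (splitLast n y).1) +
      inclVertical n (q.2 (splitLast n y).2 * p.1 (splitLast n y).1) := by
  filter_upwards [Lp.coeFn_add ((inclHorizontal n).compLpL 2 volume (tensorL n _ p.2 q.1))
    ((inclVertical n).compLpL 2 volume (tensorL n ℝ p.1 q.2)),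
    (inclHorizontal n).coeFn_compLpL (tensorL n _ p.2 q.1),
    (inclVertical n).coeFn_compLpL (tensorL n ℝ p.1 q.2), coeFn_tensorLp p.2 q.1,
    coeFn_tensorLp p.1 q.2] with y h1 h2 h3 h4 h5
  rw [sobolevTensor, h1, Pi.add_apply, h2, h3, tensorL_apply, tensorL_apply, h4, h5, smul_eq_mul]

/-- The one-dimensional test pairs `(η, η')` on the interval `(0, ℓ)`. -/
def intervalTestPairs (ℓ : ℝ) :
    Set (Lp ℝ 2 (volume : Measure ℝ) × Lp ℝ 2 (volume : Measure ℝ)) :=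
  {q | ∃ η : ℝ → ℝ, ContDiff ℝ ∞ η ∧ HasCompactSupport η ∧ tsupport η ⊆ Set.Ioo 0 ℓ ∧
    q.1 =ᵐ[volume] η ∧ q.2 =ᵐ[volume] deriv η}

/-- The open cylinder `Ω × (0, ℓ)`. -/
def openCylinder {n : ℕ} (Ω : Set (EuclideanSpace ℝ (Fin n))) (ℓ : ℝ) :
    Set (EuclideanSpace ℝ (Fin (n + 1))) := splitLast n ⁻¹' (Ω ×ˢ Set.Ioo 0 ℓ)

theorem tsupport_comp_splitLast_subset {n : ℕ} (φ : EuclideanSpace ℝ (Fin n) → ℝ) (η : ℝ → ℝ) :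
    tsupport (fun y => η (splitLast n y).2 * φ (splitLast n y).1) ⊆
      splitLast n ⁻¹' (tsupport φ ×ˢ tsupport η) := by
  refine closure_minimal (fun y hy => ?_)
    (((isClosed_tsupport φ).prod (isClosed_tsupport η)).preimage (splitLast n).continuous)
  rw [Function.mem_support] at hy
  exact ⟨subset_tsupport _ (right_ne_zero_of_mul hy), subset_tsupport _ (left_ne_zero_of_mul hy)⟩

theorem gradient_tensor {n : ℕ} {φ : EuclideanSpace ℝ (Fin n) → ℝ} {η : ℝ → ℝ}
    (hφ : Differentiable ℝ φ) (hη : Differentiable ℝ η) (y : EuclideanSpace ℝ (Fin (n + 1))) :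
    gradient (fun y => η (splitLast n y).2 * φ (splitLast n y).1) y =
      inclHorizontal n (η (splitLast n y).2 • gradient φ (splitLast n y).1) +
      inclVertical n (deriv η (splitLast n y).2 * φ (splitLast n y).1) := by
  have hfst := ((ContinuousLinearMap.fst ℝ (EuclideanSpace ℝ (Fin n)) ℝ).comp
    (splitLast n).toContinuousLinearMap).hasFDerivAt (x := y)
  have hsnd := ((ContinuousLinearMap.snd ℝ (EuclideanSpace ℝ (Fin n)) ℝ).comp
    (splitLast n).toContinuousLinearMap).hasFDerivAt (x := y)
  have h1 := (hη (splitLast n y).2).hasDerivAt.comp_hasFDerivAt y hsnd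
  have h2 := (hφ (splitLast n y).1).hasGradientAt.hasFDerivAt.comp y hfst
  refine HasGradientAt.gradient (hasGradientAt_iff_hasFDerivAt.2 ((h1.mul h2).congr_fderiv ?_))
  ext z
  rw [InnerProductSpace.toDual_apply_apply, real_inner_comm, inner_add_right,
    inner_inclHorizontal, inner_inclVertical, inner_smul_right, real_inner_comm]
  simp
  ring

theorem sobolevTensor_mem_testPairs {n : ℕ} {Ω : Set (EuclideanSpace ℝ (Fin n))} {ℓ : ℝ}
    {p : L2Scalar n × L2Field n} (hp : p ∈ testPairs Ω)
    {q : Lp ℝ 2 (volume : Measure ℝ) × Lp ℝ 2 (volume : Measure ℝ)}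
    (hq : q ∈ intervalTestPairs ℓ) : sobolevTensor p q ∈ testPairs (openCylinder Ω ℓ) := by
  obtain ⟨φ, hφ, hc, hs, h1, h2⟩ := hp
  obtain ⟨η, hη, hc', hs', h1', h2'⟩ := hq
  refine ⟨fun y => η (splitLast n y).2 * φ (splitLast n y).1, ?_, ?_, ?_, ?_, ?_⟩
  · exact (hη.comp (contDiff_snd.comp (splitLast n).contDiff)).mul
      (hφ.comp (contDiff_fst.comp (splitLast n).contDiff))
  · exact HasCompactSupport.of_support_subset_isCompact
      ((splitLast n).toHomeomorph.isCompact_preimage.2 (hc.isCompact.prod hc'.isCompact))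
      ((subset_tsupport _).trans (tsupport_comp_splitLast_subset φ η))
  · exact (tsupport_comp_splitLast_subset φ η).trans
      (Set.preimage_mono (Set.prod_mono hs hs'))
  · filter_upwards [coeFn_tensorLp p.1 q.1, ae_splitLast_fst h1, ae_splitLast_snd h1']
      with y e1 e2 e3
    rw [sobolevTensor, tensorL_apply, e1, e2, e3, smul_eq_mul]
  · filter_upwards [coeFn_sobolevTensor_snd p q, ae_splitLast_fst h1, ae_splitLast_snd h1',
      ae_splitLast_fst h2, ae_splitLast_snd h2'] with y e1 e2 e3 e4 e5
    rw [e1, e2, e3, e4, e5, gradient_tensor (hφ.differentiable (by simp))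
      (hη.differentiable (by simp))]

theorem sobolevTensor_mem_sobolevH10 {n : ℕ} {Ω : Set (EuclideanSpace ℝ (Fin n))} {ℓ : ℝ}
    {p : L2Scalar n × L2Field n} (hp : p ∈ sobolevH10 Ω)
    {q : Lp ℝ 2 (volume : Measure ℝ) × Lp ℝ 2 (volume : Measure ℝ)}
    (hq : q ∈ closure (intervalTestPairs ℓ)) :
    sobolevTensor p q ∈ sobolevH10 (openCylinder Ω ℓ) :=
  map_mem_closure₂ continuous_sobolevTensor hp hq fun _ ha _ hb =>
    sobolevTensor_mem_testPairs ha hb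

/-! ### Sines on an interval: membership in H¹₀ and completeness -/

theorem tendsto_Lp_two_of_dominated {α : Type*} [MeasurableSpace α] {μ : Measure α}
    {F : ℕ → Lp ℝ 2 μ} {G : Lp ℝ 2 μ} {bound : α → ℝ} (hb : MemLp bound 2 μ)
    (h : ∀ m, ∀ᵐ x ∂μ, |F m x - G x| ≤ bound x)
    (hlim : ∀ᵐ x ∂μ, Filter.Tendsto (fun m => F m x) Filter.atTop (nhds (G x))) :
    Filter.Tendsto F Filter.atTop (nhds G) := by
  rw [tendsto_iff_norm_sub_tendsto_zero]
  have hsq : ∀ m, ‖F m - G‖ ^ 2 = ∫ x, (F m x - G x) ^ 2 ∂μ := by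
    intro m
    rw [norm_sq_eq_integral]
    refine integral_congr_ae ?_
    filter_upwards [Lp.coeFn_sub (F m) G] with x hx
    rw [hx, Pi.sub_apply, Real.norm_eq_abs, sq_abs]
  have hT : Filter.Tendsto (fun m => ‖F m - G‖ ^ 2) Filter.atTop (nhds 0) := by
    simp only [hsq]
    have := tendsto_integral_of_dominated_convergence (μ := μ)
      (F := fun m x => (F m x - G x) ^ 2) (f := fun _ => (0 : ℝ)) (fun x => bound x ^ 2)
      (fun m => (((Lp.aestronglyMeasurable _).sub (Lp.aestronglyMeasurable _)).pow 2))
      hb.integrable_sq (fun m => ?_) ?_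
    · simpa using this
    · filter_upwards [h m] with x hx
      rw [Real.norm_eq_abs, abs_pow]
      gcongr
    · filter_upwards [hlim] with x hx
      have := (hx.sub_const (G x)).pow 2
      simpa using this
  have := hT.sqrt
  simpa using this

theorem memLp_indicator_Ioo {f : ℝ → ℝ} (hf : Continuous f) (ℓ : ℝ) :
    MemLp ((Set.Ioo 0 ℓ).indicator f) 2 volume := by
  rw [memLp_indicator_iff_restrict measurableSet_Ioo]
  obtain ⟨C, hC⟩ := (isCompact_Icc (a := 0) (b := ℓ)).exists_bound_of_continuousOn hf.continuousOn
  refine MemLp.of_bound hf.aestronglyMeasurable C ?_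
  filter_upwards [ae_restrict_mem measurableSet_Ioo] with x hx
  exact hC x (Set.Ioo_subset_Icc_self hx)

/-- The pair formed by `sin (a t)` and its derivative, cut off outside `(0, ℓ)`. -/
def sinePair (ℓ a : ℝ) : Lp ℝ 2 (volume : Measure ℝ) × Lp ℝ 2 (volume : Measure ℝ) :=
  ((memLp_indicator_Ioo (f := fun t => Real.sin (a * t)) (by fun_prop) ℓ).toLp _,
    (memLp_indicator_Ioo (f := fun t => a * Real.cos (a * t)) (by fun_prop) ℓ).toLp _)

theorem coeFn_sinePair_fst (ℓ a : ℝ) : (sinePair ℓ a).1 =ᵐ[volume]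
    (Set.Ioo 0 ℓ).indicator fun t => Real.sin (a * t) :=
  (memLp_indicator_Ioo (by fun_prop) ℓ).coeFn_toLp

theorem coeFn_sinePair_snd (ℓ a : ℝ) : (sinePair ℓ a).2 =ᵐ[volume]
    (Set.Ioo 0 ℓ).indicator fun t => a * Real.cos (a * t) :=
  (memLp_indicator_Ioo (by fun_prop) ℓ).coeFn_toLp

theorem deriv_smoothTransition_of_one_lt {x : ℝ} (hx : 1 < x) :
    deriv Real.smoothTransition x = 0 := by
  have : Real.smoothTransition =ᶠ[nhds x] fun _ => 1 := by
    filter_upwards [Ioi_mem_nhds hx] with y hy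
    exact Real.smoothTransition.one_of_one_le (le_of_lt hy)
  rw [this.deriv_eq, deriv_const]

/-- The derivative of `y ↦ y σ(y² - 1)` as a function of `r = y²`, where `σ` is the smooth
transition function. -/
def cutoffSlope (r : ℝ) : ℝ :=
  Real.smoothTransition (r - 1) + 2 * r * deriv Real.smoothTransition (r - 1)

theorem continuous_cutoffSlope : Continuous cutoffSlope := by
  have h1 : Continuous Real.smoothTransition := Real.smoothTransition.continuous
  have h2 : Continuous (deriv Real.smoothTransition) :=
    (Real.smoothTransition.contDiff (n := 1)).continuous_deriv le_rfl
  unfold cutoffSlope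
  fun_prop

theorem cutoffSlope_of_two_lt {r : ℝ} (hr : 2 < r) : cutoffSlope r = 1 := by
  rw [cutoffSlope, deriv_smoothTransition_of_one_lt (by linarith),
    Real.smoothTransition.one_of_one_le (by linarith)]
  simp

/-- The slope of the cut-off depends on N and t only through r = N² sin²(at), so this bound is
uniform in N and dominates the derivatives. -/
theorem exists_cutoffSlope_bound : ∃ C, 1 ≤ C ∧ ∀ r, 0 ≤ r → |cutoffSlope r| ≤ C := by
  obtain ⟨C, hC⟩ := (isCompact_Icc (a := (0 : ℝ)) (b := 2)).exists_bound_of_continuousOn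
    continuous_cutoffSlope.continuousOn
  refine ⟨max C 1, le_max_right _ _, fun r hr => ?_⟩
  by_cases h : r ≤ 2
  · exact (hC r ⟨hr, h⟩).trans (le_max_left _ _)
  · rw [cutoffSlope_of_two_lt (not_le.1 h), abs_one]
    exact le_max_right _ _

/-- `sin (a t)` with its values below the level `1 / N` smoothly removed. -/
def cutSine (a N t : ℝ) : ℝ :=
  Real.sin (a * t) * Real.smoothTransition (N ^ 2 * Real.sin (a * t) ^ 2 - 1)

theorem contDiff_cutSine (a N : ℝ) : ContDiff ℝ ∞ (cutSine a N) := by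
  have h1 : ContDiff ℝ ∞ fun t => Real.sin (a * t) :=
    Real.contDiff_sin.comp (contDiff_const.mul contDiff_id)
  exact h1.mul (Real.smoothTransition.contDiff.comp
    ((contDiff_const.mul (h1.pow 2)).sub contDiff_const))

theorem cutSine_eq_zero {a N t : ℝ} (h : N ^ 2 * Real.sin (a * t) ^ 2 ≤ 1) :
    cutSine a N t = 0 := by
  rw [cutSine, Real.smoothTransition.zero_of_nonpos (by linarith), mul_zero]

theorem hasDerivAt_cutSine (a N t : ℝ) : HasDerivAt (cutSine a N)
    (a * Real.cos (a * t) * cutoffSlope (N ^ 2 * Real.sin (a * t) ^ 2)) t := by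
  have h0 : HasDerivAt (fun t => a * t) a t := by simpa using (hasDerivAt_id t).const_mul a
  have h1 := h0.sin
  have h2 := ((h1.pow 2).const_mul (N ^ 2)).sub_const 1
  have hd : DifferentiableAt ℝ Real.smoothTransition (N ^ 2 * Real.sin (a * t) ^ 2 - 1) :=
    (Real.smoothTransition.contDiff (n := 1)).differentiable one_ne_zero _
  have h3 := hd.hasDerivAt.comp t h2
  refine (h1.mul h3).congr_deriv ?_
  simp [cutoffSlope]
  ring

/-- At both endpoints sin(at) vanishes, so the cut sine is already zero nearby. Cutting off outside
(0, ℓ) therefore keeps it smooth, with support inside the open interval. -/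
theorem indicator_cutSine_eventually_zero {ℓ a N t : ℝ} (hsin : Real.sin (a * ℓ) = 0)
    (ht : t ∉ Set.Ioo 0 ℓ) :
    (Set.Ioo 0 ℓ).indicator (cutSine a N) =ᶠ[nhds t] fun _ => 0 := by
  have hcase : t < 0 ∨ ℓ < t ∨ t = 0 ∨ t = ℓ := by
    rw [Set.mem_Ioo, not_and_or, not_lt, not_lt] at ht
    rcases ht with h | h
    · rcases h.lt_or_eq with h | h <;> simp [h]
    · rcases h.lt_or_eq with h | h <;> simp [h]
  have hnear : Real.sin (a * t) = 0 →
      (Set.Ioo 0 ℓ).indicator (cutSine a N) =ᶠ[nhds t] fun _ => 0 := by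
    intro h0
    have hcont : Continuous fun s => N ^ 2 * Real.sin (a * s) ^ 2 := by fun_prop
    have : ∀ᶠ s in nhds t, N ^ 2 * Real.sin (a * s) ^ 2 < 1 :=
      hcont.continuousAt.eventually_lt continuousAt_const (by simp [h0])
    filter_upwards [this] with s hs
    by_cases h : s ∈ Set.Ioo 0 ℓ
    · rw [Set.indicator_of_mem h, cutSine_eq_zero hs.le]
    · rw [Set.indicator_of_notMem h]
  rcases hcase with h | h | h | h
  · filter_upwards [Iio_mem_nhds h] with s hs
    exact Set.indicator_of_notMem (fun h' => lt_asymm h'.1 hs) _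
  · filter_upwards [Ioi_mem_nhds h] with s hs
    exact Set.indicator_of_notMem (fun h' => lt_asymm h'.2 hs) _
  · exact hnear (by simp [h])
  · exact hnear (by rw [h, hsin])

theorem indicator_cutSine_eventuallyEq {ℓ a N t : ℝ} (ht : t ∈ Set.Ioo 0 ℓ) :
    (Set.Ioo 0 ℓ).indicator (cutSine a N) =ᶠ[nhds t] cutSine a N := by
  filter_upwards [isOpen_Ioo.mem_nhds ht] with s hs
  exact Set.indicator_of_mem hs _

theorem exists_intervalTestPair_cutSine {ℓ a : ℝ} (hsin : Real.sin (a * ℓ) = 0) (N : ℝ) :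
    ∃ q ∈ intervalTestPairs ℓ, q.1 =ᵐ[volume] (Set.Ioo 0 ℓ).indicator (cutSine a N) ∧
      q.2 =ᵐ[volume] (Set.Ioo 0 ℓ).indicator fun t =>
        a * Real.cos (a * t) * cutoffSlope (N ^ 2 * Real.sin (a * t) ^ 2) := by
  have hcs := continuous_cutoffSlope
  have h1 := memLp_indicator_Ioo (contDiff_cutSine a N).continuous ℓ
  have h2 := memLp_indicator_Ioo (f := fun t =>
    a * Real.cos (a * t) * cutoffSlope (N ^ 2 * Real.sin (a * t) ^ 2)) (by fun_prop) ℓ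
  have hderiv : deriv ((Set.Ioo 0 ℓ).indicator (cutSine a N)) =
      (Set.Ioo 0 ℓ).indicator fun t =>
        a * Real.cos (a * t) * cutoffSlope (N ^ 2 * Real.sin (a * t) ^ 2) := by
    ext t
    by_cases ht : t ∈ Set.Ioo 0 ℓ
    · rw [(indicator_cutSine_eventuallyEq ht).deriv_eq, (hasDerivAt_cutSine a N t).deriv,
        Set.indicator_of_mem ht]
    · rw [(indicator_cutSine_eventually_zero hsin ht).deriv_eq, deriv_const,
        Set.indicator_of_notMem ht]
  have hsub : tsupport ((Set.Ioo 0 ℓ).indicator (cutSine a N)) ⊆ Set.Ioo 0 ℓ := by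
    intro t ht
    by_contra hnot
    exact (notMem_tsupport_iff_eventuallyEq.2 (indicator_cutSine_eventually_zero hsin hnot)) ht
  refine ⟨(h1.toLp _, h2.toLp _), ⟨(Set.Ioo 0 ℓ).indicator (cutSine a N), ?_, ?_, hsub,
    h1.coeFn_toLp, ?_⟩, h1.coeFn_toLp, h2.coeFn_toLp⟩
  · rw [contDiff_iff_contDiffAt]
    intro t
    by_cases ht : t ∈ Set.Ioo 0 ℓ
    · exact (contDiff_cutSine a N).contDiffAt.congr_of_eventuallyEq
        (indicator_cutSine_eventuallyEq ht)
    · exact contDiffAt_const.congr_of_eventuallyEq (indicator_cutSine_eventually_zero hsin ht)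
  · exact isCompact_Icc.of_isClosed_subset (isClosed_tsupport _)
      (hsub.trans Set.Ioo_subset_Icc_self)
  · rw [hderiv]
    exact h2.coeFn_toLp

theorem ae_sin_mul_ne_zero {a : ℝ} (ha : a ≠ 0) :
    ∀ᵐ t ∂(volume : Measure ℝ), Real.sin (a * t) ≠ 0 := by
  have : {t : ℝ | Real.sin (a * t) = 0}.Countable := by
    refine (Set.countable_range fun k : ℤ => k * Real.pi / a).mono fun t ht => ?_
    obtain ⟨k, hk⟩ := Real.sin_eq_zero_iff.1 ht
    exact ⟨k, by simp only [hk]; field_simp⟩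
  filter_upwards [this.ae_notMem volume] with t ht using ht

/-- As N → ∞ the cut sines and their derivatives become eventually equal to the sine and its
derivative wherever sin(at) ≠ 0, hence almost everywhere; dominated convergence does the rest. -/
theorem sinePair_mem_closure {ℓ a : ℝ} (ha : a ≠ 0) (hsin : Real.sin (a * ℓ) = 0) :
    sinePair ℓ a ∈ closure (intervalTestPairs ℓ) := by
  choose q hq h1 h2 using fun N : ℕ => exists_intervalTestPair_cutSine hsin (N : ℝ)
  obtain ⟨C, hC1, hC⟩ := exists_cutoffSlope_bound
  have hlarge : ∀ t, Real.sin (a * t) ≠ 0 →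
      ∀ᶠ N : ℕ in Filter.atTop, 2 < (N : ℝ) ^ 2 * Real.sin (a * t) ^ 2 := by
    intro t ht
    have hpos : 0 < Real.sin (a * t) ^ 2 := by positivity
    have : Filter.Tendsto (fun N : ℕ => (N : ℝ) ^ 2 * Real.sin (a * t) ^ 2) Filter.atTop
        Filter.atTop :=
      ((Filter.tendsto_pow_atTop two_ne_zero).comp tendsto_natCast_atTop_atTop).atTop_mul_const hpos
    exact this.eventually_gt_atTop 2
  refine mem_closure_of_tendsto (b := Filter.atTop) (f := q) ?_ (Filter.Eventually.of_forall hq)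
  refine (Prod.tendsto_iff _ _).2 ⟨?_, ?_⟩
  · refine tendsto_Lp_two_of_dominated
      (memLp_indicator_Ioo (f := fun _ => (1 : ℝ)) continuous_const ℓ) (fun N => ?_) ?_
    · filter_upwards [h1 N, coeFn_sinePair_fst ℓ a] with t e1 e2
      rw [e1, e2]
      by_cases ht : t ∈ Set.Ioo 0 ℓ
      · simp only [Set.indicator_of_mem ht, cutSine]
        rw [show ∀ s r : ℝ, s * r - s = -(s * (1 - r)) by intros; ring, abs_neg, abs_mul]
        have h0 := Real.smoothTransition.nonneg ((N : ℝ) ^ 2 * Real.sin (a * t) ^ 2 - 1)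
        have h3 := Real.smoothTransition.le_one ((N : ℝ) ^ 2 * Real.sin (a * t) ^ 2 - 1)
        rw [abs_of_nonneg (by linarith : 0 ≤ 1 - Real.smoothTransition _)]
        exact mul_le_one₀ (Real.abs_sin_le_one _) (by linarith) (by linarith)
      · simp [Set.indicator_of_notMem ht]
    · filter_upwards [ae_all_iff.2 h1, coeFn_sinePair_fst ℓ a, ae_sin_mul_ne_zero ha]
        with t e1 e2 ht0
      simp only [e1, e2]
      refine tendsto_const_nhds.congr' ?_
      filter_upwards [hlarge t ht0] with N hN
      by_cases ht : t ∈ Set.Ioo 0 ℓ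
      · simp only [Set.indicator_of_mem ht, cutSine]
        rw [Real.smoothTransition.one_of_one_le (by linarith), mul_one]
      · simp only [Set.indicator_of_notMem ht]
  · refine tendsto_Lp_two_of_dominated
      (memLp_indicator_Ioo (f := fun _ => |a| * (C + 1)) continuous_const ℓ) (fun N => ?_) ?_
    · filter_upwards [h2 N, coeFn_sinePair_snd ℓ a] with t e1 e2
      rw [e1, e2]
      by_cases ht : t ∈ Set.Ioo 0 ℓ
      · simp only [Set.indicator_of_mem ht]
        rw [show ∀ b c r : ℝ, b * c * r - b * c = b * (c * (r - 1)) by intros; ring, abs_mul,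
          abs_mul]
        have h0 := hC ((N : ℝ) ^ 2 * Real.sin (a * t) ^ 2) (by positivity)
        have h3 : |cutoffSlope ((N : ℝ) ^ 2 * Real.sin (a * t) ^ 2) - 1| ≤ C + 1 :=
          (abs_sub _ _).trans (by rw [abs_one]; linarith)
        have h4 := mul_le_mul (Real.abs_cos_le_one (a * t)) h3 (abs_nonneg _) zero_le_one
        rw [one_mul] at h4
        exact mul_le_mul_of_nonneg_left h4 (abs_nonneg _)
      · simp [Set.indicator_of_notMem ht]
    · filter_upwards [ae_all_iff.2 h2, coeFn_sinePair_snd ℓ a, ae_sin_mul_ne_zero ha]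
        with t e1 e2 ht0
      simp only [e1, e2]
      refine tendsto_const_nhds.congr' ?_
      filter_upwards [hlarge t ht0] with N hN
      by_cases ht : t ∈ Set.Ioo 0 ℓ
      · simp only [Set.indicator_of_mem ht]
        rw [cutoffSlope_of_two_lt hN, mul_one]
      · simp only [Set.indicator_of_notMem ht]

/-- Completeness of the sines on `(0, ℓ)`. -/
theorem ae_eq_zero_of_integral_sin_eq_zero {ℓ : ℝ} (hℓ : 0 < ℓ) {f : ℝ → ℝ}
    (hf : MemLp f 2 volume) (hsupp : ∀ᵐ t ∂(volume : Measure ℝ), t ∉ Set.Ioo 0 ℓ → f t = 0)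
    (h : ∀ j : ℕ, 1 ≤ j → ∫ t, Real.sin (j * Real.pi / ℓ * t) * f t = 0) :
    f =ᵐ[volume] 0 := by
  -- Odd reflection of f. Its Fourier coefficients on (-ℓ, ℓ) involve only the sine integrals of f.
  set F : ℝ → ℝ := fun t => f t - f (-t) with hF
  have hneg : MemLp (fun t => f (-t)) 2 volume :=
    hf.comp_measurePreserving (Measure.measurePreserving_neg volume)
  have hFL : MemLp F 2 volume := hf.sub hneg
  have hsupp' : ∀ᵐ t ∂(volume : Measure ℝ), -t ∉ Set.Ioo 0 ℓ → f (-t) = 0 :=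
    (Measure.measurePreserving_neg (volume : Measure ℝ)).quasiMeasurePreserving.ae hsupp
  have hInt : Integrable f := by
    have h1 : IntegrableOn f (Set.Ioo 0 ℓ) :=
      (hf.restrict _).integrable (by norm_num)
    rw [← integrable_indicator_iff measurableSet_Ioo] at h1
    refine h1.congr ?_
    filter_upwards [hsupp] with t ht
    by_cases h : t ∈ Set.Ioo 0 ℓ
    · simp [h]
    · simp [h, ht h]
  have hsin : ∀ m : ℤ, ∫ t, Real.sin (m * Real.pi / ℓ * t) * f t = 0 := by
    intro m
    rcases lt_trichotomy m 0 with hm | hm | hm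
    · have := h m.natAbs (by omega)
      rw [Nat.cast_natAbs, abs_of_neg hm] at this
      push_cast at this
      have e : ∀ t, Real.sin (m * Real.pi / ℓ * t) * f t
          = -(Real.sin (-m * Real.pi / ℓ * t) * f t) := by
        intro t
        rw [← neg_mul, ← Real.sin_neg]; congr 2; ring
      simp only [e]
      rw [integral_neg, this, neg_zero]
    · simp [hm]
    · have := h m.natAbs (by omega)
      rwa [Nat.cast_natAbs, abs_of_pos hm] at this
  have hab : -ℓ < ℓ := by linarith
  have hcoeff : ∀ m : ℤ, fourierCoeffOn hab (fun t => (F t : ℂ)) m = 0 := by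
    intro m
    rw [fourierCoeffOn_eq_integral]
    have e1 : ∫ x : ℝ in (-ℓ)..ℓ, fourier (-m) (x : AddCircle (ℓ - -ℓ)) • (F x : ℂ)
        = ∫ x : ℝ, fourier (-m) (x : AddCircle (ℓ - -ℓ)) • (F x : ℂ) := by
      rw [intervalIntegral.integral_of_le hab.le]
      refine setIntegral_eq_integral_of_ae_compl_eq_zero ?_
      filter_upwards [hsupp, hsupp'] with t h1 h2 ht
      have h3 : t ∉ Set.Ioo 0 ℓ := fun h => ht ⟨by linarith [h.1], h.2.le⟩
      have h4 : -t ∉ Set.Ioo 0 ℓ := fun h => ht ⟨by linarith [h.2], by linarith [h.1]⟩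
      simp [hF, h1 h3, h2 h4]
    have hcont : Continuous fun x : ℝ => (fourier (-m) (x : AddCircle (ℓ - -ℓ)) : ℂ) :=
      (map_continuous _).comp (AddCircle.continuous_mk' _)
    have hbd : ∀ x : ℝ, ‖(fourier (-m) (x : AddCircle (ℓ - -ℓ)) : ℂ)‖ ≤ 1 := by
      intro x
      rw [fourier_apply, Circle.norm_coe]
    have hi1 : Integrable fun x : ℝ => (fourier (-m) (x : AddCircle (ℓ - -ℓ)) : ℂ) * (f x : ℂ) :=
      hInt.ofReal.bdd_mul (c := 1) hcont.aestronglyMeasurable (Filter.Eventually.of_forall hbd)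
    have hi2 : Integrable fun x : ℝ =>
        (fourier (-m) (x : AddCircle (ℓ - -ℓ)) : ℂ) * (f (-x) : ℂ) :=
      hInt.comp_neg.ofReal.bdd_mul (c := 1) hcont.aestronglyMeasurable
        (Filter.Eventually.of_forall hbd)
    have e2 : ∫ x : ℝ, fourier (-m) (x : AddCircle (ℓ - -ℓ)) • (F x : ℂ) = 0 := by
      have e3 : ∫ x : ℝ, fourier (-m) (x : AddCircle (ℓ - -ℓ)) • (F x : ℂ) =
          (∫ x : ℝ, (fourier (-m) (x : AddCircle (ℓ - -ℓ)) : ℂ) * (f x : ℂ)) -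
          ∫ x : ℝ, (fourier (-m) ((-x : ℝ) : AddCircle (ℓ - -ℓ)) : ℂ) * (f x : ℂ) := by
        have := integral_neg_eq_self (fun x : ℝ =>
          (fourier (-m) (x : AddCircle (ℓ - -ℓ)) : ℂ) * (f (-x) : ℂ)) volume
        simp only [neg_neg] at this
        rw [this, ← integral_sub hi1 hi2]
        congr 1 with x
        simp only [hF, smul_eq_mul]
        push_cast
        ring
      rw [e3, ← integral_sub hi1 (by simpa using hi2.comp_neg)]
      -- After x ↦ -x in the reflected half, the two exponentials combine into a multiple of the
      -- sine.
      have e4 : ∀ x : ℝ, (fourier (-m) (x : AddCircle (ℓ - -ℓ)) : ℂ) * (f x : ℂ) -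
          (fourier (-m) ((-x : ℝ) : AddCircle (ℓ - -ℓ)) : ℂ) * (f x : ℂ)
          = -2 * Complex.I * ((Real.sin (m * Real.pi / ℓ * x) * f x : ℝ) : ℂ) := by
        intro x
        rw [fourier_coe_apply, fourier_coe_apply]
        have hℓ' : (ℓ : ℂ) ≠ 0 := by exact_mod_cast hℓ.ne'
        rw [show 2 * (Real.pi : ℂ) * Complex.I * ((-m : ℤ) : ℂ) * (x : ℂ) / ((ℓ - -ℓ : ℝ) : ℂ)
          = (-((m * Real.pi / ℓ * x : ℝ) : ℂ)) * Complex.I by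
            push_cast; field_simp; ring,
          show 2 * (Real.pi : ℂ) * Complex.I * ((-m : ℤ) : ℂ) * ((-x : ℝ) : ℂ) / ((ℓ - -ℓ : ℝ) : ℂ)
          = (((m * Real.pi / ℓ * x : ℝ) : ℂ)) * Complex.I by
            push_cast; field_simp; ring, Complex.exp_mul_I, Complex.exp_mul_I, Complex.cos_neg,
            Complex.sin_neg]
        push_cast
        ring
      simp only [e4]
      rw [integral_const_mul, integral_complex_ofReal, hsin]
      simp
    rw [e1, e2, smul_zero]
  -- Parseval: all coefficients vanish, hence so does F almost everywhere on (-ℓ, ℓ).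
  have hsum := hasSum_sq_fourierCoeffOn hab (f := fun t => (F t : ℂ)) (hFL.ofReal.restrict _)
  simp only [hcoeff, norm_zero, ne_eq, OfNat.ofNat_ne_zero, not_false_eq_true, zero_pow] at hsum
  have hz := hsum.unique hasSum_zero
  rw [smul_eq_mul, mul_eq_zero] at hz
  have hz' := hz.resolve_left (inv_ne_zero (by linarith))
  simp only [Complex.norm_real] at hz'
  rw [intervalIntegral.integral_of_le hab.le, integral_eq_zero_iff_of_nonneg_ae
    (Filter.Eventually.of_forall fun t => by positivity)
    ((hFL.integrable_norm_pow (by norm_num : (2 : ℕ) ≠ 0)).integrableOn)] at hz'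
  have hz'' := (ae_restrict_iff' measurableSet_Ioc).1 hz'
  filter_upwards [hsupp, hsupp', hz''] with t h1 h2 h3
  by_cases ht : t ∈ Set.Ioo 0 ℓ
  · have h4 := h3 ⟨by linarith [ht.1], ht.2.le⟩
    have h5 : f (-t) = 0 := h2 fun h => by linarith [h.1, ht.1]
    simpa [hF, h5] using h4
  · exact h1 ht

/-! ### Separation of variables in the weak formulation -/

theorem integrable_inner_of_memLp_two {α E : Type*} [MeasurableSpace α] {μ : Measure α}
    [NormedAddCommGroup E] [InnerProductSpace ℝ E] {f g : α → E} (hf : MemLp f 2 μ)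
    (hg : MemLp g 2 μ) : Integrable (fun x => inner ℝ (f x) (g x)) μ := by
  refine (L2.integrable_inner (𝕜 := ℝ) (hf.toLp f) (hg.toLp g)).congr ?_
  filter_upwards [hf.coeFn_toLp, hg.coeFn_toLp] with x h1 h2
  rw [h1, h2]

section Slices

variable {n : ℕ} {Φ : EuclideanSpace ℝ (Fin (n + 1)) → ℝ}

theorem gradient_eq_zero_of_notMem_tsupport {y : EuclideanSpace ℝ (Fin (n + 1))}
    (hy : y ∉ tsupport Φ) : gradient Φ y = 0 := by
  have : fderiv ℝ Φ y = 0 := by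
    by_contra h
    exact hy (support_fderiv_subset ℝ h)
  rw [gradient, this, map_zero]

theorem gradient_slice_horizontal (hΦ : ContDiff ℝ ∞ Φ) (x : EuclideanSpace ℝ (Fin n)) (t : ℝ) :
    gradient (fun x => Φ ((splitLast n).symm (x, t))) x =
      (splitLast n (gradient Φ ((splitLast n).symm (x, t)))).1 := by
  have h1 : HasFDerivAt (fun x => (splitLast n).symm (x, t)) (inclHorizontal n) x := by
    simp only [splitLast_symm_apply]
    exact (inclHorizontal n).hasFDerivAt.add_const _
  have hd : DifferentiableAt ℝ Φ ((splitLast n).symm (x, t)) := hΦ.differentiable (by simp) _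
  refine HasGradientAt.gradient (hasGradientAt_iff_hasFDerivAt.2
    ((hd.hasGradientAt.hasFDerivAt.comp x h1).congr_fderiv ?_))
  ext h
  rw [ContinuousLinearMap.comp_apply, InnerProductSpace.toDual_apply_apply,
    InnerProductSpace.toDual_apply_apply, inner_inclHorizontal]

theorem hasDerivAt_slice_vertical (hΦ : ContDiff ℝ ∞ Φ) (x : EuclideanSpace ℝ (Fin n)) (t : ℝ) :
    HasDerivAt (fun t => Φ ((splitLast n).symm (x, t)))
      (splitLast n (gradient Φ ((splitLast n).symm (x, t)))).2 t := by
  have h1 : HasDerivAt (fun t => (splitLast n).symm (x, t)) (inclVertical n 1) t := by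
    simp only [splitLast_symm_apply]
    exact (inclVertical n).hasDerivAt.const_add _
  have hd : DifferentiableAt ℝ Φ ((splitLast n).symm (x, t)) := hΦ.differentiable (by simp) _
  refine (hd.hasGradientAt.hasFDerivAt.comp_hasDerivAt t h1).congr_deriv ?_
  rw [InnerProductSpace.toDual_apply_apply, inner_inclVertical, mul_one]

theorem tsupport_slice_horizontal (t : ℝ) :
    tsupport (fun x => Φ ((splitLast n).symm (x, t))) ⊆
      (fun x => (splitLast n).symm (x, t)) ⁻¹' tsupport Φ :=
  tsupport_comp_subset_preimage Φ (by fun_prop)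

theorem hasCompactSupport_slice_horizontal (hc : HasCompactSupport Φ) (t : ℝ) :
    HasCompactSupport (fun x => Φ ((splitLast n).symm (x, t))) := by
  have hK : IsCompact ((fun y => (splitLast n y).1) '' tsupport Φ) :=
    hc.isCompact.image (by fun_prop)
  refine HasCompactSupport.of_support_subset_isCompact hK fun x hx => ?_
  exact ⟨_, tsupport_slice_horizontal t (subset_tsupport _ hx), by simp⟩

theorem hasCompactSupport_slice_vertical (hc : HasCompactSupport Φ)
    (x : EuclideanSpace ℝ (Fin n)) :
    HasCompactSupport (fun t => Φ ((splitLast n).symm (x, t))) := by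
  have hK : IsCompact ((fun y => (splitLast n y).2) '' tsupport Φ) :=
    hc.isCompact.image (by fun_prop)
  refine HasCompactSupport.of_support_subset_isCompact hK fun t ht => ?_
  exact ⟨_, subset_tsupport _ ht, by simp⟩

/-- One integration by parts. The slice has compact support inside (0, ℓ), so the cut-off may be
dropped under the integral and no boundary terms appear. -/
theorem integral_slice_vertical (hΦ : ContDiff ℝ ∞ Φ) (hc : HasCompactSupport Φ)
    {Ω : Set (EuclideanSpace ℝ (Fin n))} {ℓ : ℝ} (hs : tsupport Φ ⊆ openCylinder Ω ℓ) (a : ℝ)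
    (x : EuclideanSpace ℝ (Fin n)) :
    ∫ t, (sinePair ℓ a).2 t * (splitLast n (gradient Φ ((splitLast n).symm (x, t)))).2 =
      a ^ 2 * ∫ t, (sinePair ℓ a).1 t * Φ ((splitLast n).symm (x, t)) := by
  have hout : ∀ t ∉ Set.Ioo 0 ℓ, (splitLast n).symm (x, t) ∉ tsupport Φ := fun t ht h =>
    ht (by simpa [openCylinder] using (hs h).2)
  have hcont : Continuous fun t => Φ ((splitLast n).symm (x, t)) :=
    hΦ.continuous.comp (by fun_prop)
  have hcs := hasCompactSupport_slice_vertical hc x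
  have hV : Continuous fun t => (splitLast n (gradient Φ ((splitLast n).symm (x, t)))).2 := by
    have := continuous_gradient hΦ
    fun_prop
  have hVc : HasCompactSupport fun t =>
      (splitLast n (gradient Φ ((splitLast n).symm (x, t)))).2 := by
    refine HasCompactSupport.of_support_subset_isCompact hcs.isCompact ?_
    have : (fun t => (splitLast n (gradient Φ ((splitLast n).symm (x, t)))).2) =
        deriv fun t => Φ ((splitLast n).symm (x, t)) :=
      funext fun t => (hasDerivAt_slice_vertical hΦ x t).deriv.symm
    rw [this]
    exact support_deriv_subset
  have e1 : ∫ t, (sinePair ℓ a).2 t * (splitLast n (gradient Φ ((splitLast n).symm (x, t)))).2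
      = ∫ t, a * Real.cos (a * t) *
        (splitLast n (gradient Φ ((splitLast n).symm (x, t)))).2 := by
    refine integral_congr_ae ?_
    filter_upwards [coeFn_sinePair_snd ℓ a] with t ht
    rw [ht]
    by_cases h : t ∈ Set.Ioo 0 ℓ
    · rw [Set.indicator_of_mem h]
    · rw [gradient_eq_zero_of_notMem_tsupport (hout t h)]
      simp
  have e2 : ∫ t, (sinePair ℓ a).1 t * Φ ((splitLast n).symm (x, t))
      = ∫ t, Real.sin (a * t) * Φ ((splitLast n).symm (x, t)) := by
    refine integral_congr_ae ?_
    filter_upwards [coeFn_sinePair_fst ℓ a] with t ht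
    rw [ht]
    by_cases h : t ∈ Set.Ioo 0 ℓ
    · rw [Set.indicator_of_mem h]
    · rw [image_eq_zero_of_notMem_tsupport (hout t h)]
      simp
  have hcos : ∀ t, HasDerivAt (fun t => a * Real.cos (a * t)) (-(a ^ 2 * Real.sin (a * t))) t := by
    intro t
    have h0 : HasDerivAt (fun t => a * t) a t := by simpa using (hasDerivAt_id t).const_mul a
    refine (h0.cos.const_mul a).congr_deriv ?_
    ring
  rw [e1, e2, integral_mul_deriv_eq_deriv_mul_of_integrable (fun t _ => hcos t)
    (fun t _ => hasDerivAt_slice_vertical hΦ x t), ← integral_neg, ← integral_const_mul]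
  · congr 1 with t
    ring
  · exact ((by fun_prop : Continuous fun t => a * Real.cos (a * t)).mul hV
      ).integrable_of_hasCompactSupport hVc.mul_left
  · exact ((by fun_prop : Continuous fun t => -(a ^ 2 * Real.sin (a * t))).mul hcont
      ).integrable_of_hasCompactSupport hcs.mul_left
  · exact ((by fun_prop : Continuous fun t => a * Real.cos (a * t)).mul hcont
      ).integrable_of_hasCompactSupport hcs.mul_left

end Slices

/-- By Fubini: horizontal slices of a test function are test functions on Ω, where the equation of g
gives τ, and integration by parts on vertical lines gives a². -/
theorem inner_sobolevTensor_testPair {n : ℕ} {Ω : Set (EuclideanSpace ℝ (Fin n))} {ℓ a τ : ℝ}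
    {g : L2Scalar n × L2Field n} (hg : IsDirichletEigenfunction Ω τ g)
    {w : L2Scalar (n + 1) × L2Field (n + 1)} (hw : w ∈ testPairs (openCylinder Ω ℓ)) :
    inner ℝ (sobolevTensor g (sinePair ℓ a)).2 w.2 =
      (τ + a ^ 2) * inner ℝ (sobolevTensor g (sinePair ℓ a)).1 w.1 := by
  obtain ⟨Φ, hΦ, hc, hs, h1, h2⟩ := hw
  set s := (sinePair ℓ a).1
  set c := (sinePair ℓ a).2
  have hgc := continuous_gradient hΦ
  have hgs := hasCompactSupport_gradient hc
  have hΦc := hΦ.continuous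
  have hΨL : MemLp (fun p => Φ ((splitLast n).symm p)) 2 (volume.prod volume) :=
    Continuous.memLp_of_hasCompactSupport (by fun_prop)
      (hc.comp_homeomorph (splitLast n).symm.toHomeomorph)
  have hNs : HasCompactSupport fun p => gradient Φ ((splitLast n).symm p) :=
    hgs.comp_homeomorph (splitLast n).symm.toHomeomorph
  have hHL : MemLp (fun p => (splitLast n (gradient Φ ((splitLast n).symm p))).1) 2
      (volume.prod volume) :=
    Continuous.memLp_of_hasCompactSupport (by fun_prop)
      (hNs.comp_left (g := fun y => (splitLast n y).1) (by simp))
  have hVL : MemLp (fun p => (splitLast n (gradient Φ ((splitLast n).symm p))).2) 2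
      (volume.prod volume) :=
    Continuous.memLp_of_hasCompactSupport (by fun_prop)
      (hNs.comp_left (g := fun y => (splitLast n y).2) (by simp))
  have hA := integrable_inner_of_memLp_two (memLp_prod_smul g.2 s) hHL
  have hB := integrable_inner_of_memLp_two (memLp_prod_smul g.1 c) hVL
  have hC := integrable_inner_of_memLp_two (memLp_prod_smul g.1 s) hΨL
  have eL : inner ℝ (sobolevTensor g (sinePair ℓ a)).2 w.2 =
      (∫ p, inner ℝ (s p.2 • g.2 p.1) (splitLast n (gradient Φ ((splitLast n).symm p))).1
        ∂(volume.prod volume)) +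
      ∫ p, inner ℝ (c p.2 • g.1 p.1) (splitLast n (gradient Φ ((splitLast n).symm p))).2
        ∂(volume.prod volume) := by
    rw [← integral_add hA hB, L2.inner_def, ← (measurePreserving_splitLast n).integral_comp
      (measurableEmbedding_splitLast n)]
    refine integral_congr_ae ?_
    filter_upwards [coeFn_sobolevTensor_snd g (sinePair ℓ a), h2] with y e1 e2
    rw [e1, e2, real_inner_comm, inner_add_right, inner_inclHorizontal, inner_inclVertical,
      ContinuousLinearEquiv.symm_apply_apply, real_inner_comm]
    simp [s, c]
  have eR : inner ℝ (sobolevTensor g (sinePair ℓ a)).1 w.1 =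
      ∫ p, inner ℝ (s p.2 • g.1 p.1) (Φ ((splitLast n).symm p)) ∂(volume.prod volume) := by
    rw [L2.inner_def, ← (measurePreserving_splitLast n).integral_comp
      (measurableEmbedding_splitLast n)]
    refine integral_congr_ae ?_
    filter_upwards [coeFn_tensorLp g.1 s, h1] with y e1 e2
    rw [sobolevTensor, tensorL_apply, e1, e2, ContinuousLinearEquiv.symm_apply_apply]
  have eH : ∫ p, inner ℝ (s p.2 • g.2 p.1) (splitLast n (gradient Φ ((splitLast n).symm p))).1
        ∂(volume.prod volume) = τ * ∫ p, inner ℝ (s p.2 • g.1 p.1) (Φ ((splitLast n).symm p))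
        ∂(volume.prod volume) := by
    rw [integral_prod_symm _ hA, integral_prod_symm _ hC, ← integral_const_mul]
    congr 1 with t
    simp only [real_inner_smul_left]
    rw [integral_const_mul, integral_const_mul, mul_left_comm]
    congr 1
    obtain ⟨p, hp, e1, e2⟩ := exists_testPair (U := Ω)
      (hΦ.comp (by
        simp only [splitLast_symm_apply]
        exact (inclHorizontal n).contDiff.add contDiff_const :
        ContDiff ℝ ∞ fun x => (splitLast n).symm (x, t)))
      (hasCompactSupport_slice_horizontal hc t)
      (fun x hx => by simpa [openCylinder] using (hs (tsupport_slice_horizontal t hx)).1)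
    have := hg.2.2 p (subset_closure hp)
    rw [L2.inner_def, L2.inner_def] at this
    convert this using 1
    · refine integral_congr_ae ?_
      filter_upwards [e2] with x hx
      rw [hx]
      exact congrArg _ (gradient_slice_horizontal hΦ x t).symm
    · congr 1
      refine integral_congr_ae ?_
      filter_upwards [e1] with x hx
      rw [hx]
      rfl
  have eV : ∫ p, inner ℝ (c p.2 • g.1 p.1) (splitLast n (gradient Φ ((splitLast n).symm p))).2
        ∂(volume.prod volume) = a ^ 2 * ∫ p, inner ℝ (s p.2 • g.1 p.1) (Φ ((splitLast n).symm p))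
        ∂(volume.prod volume) := by
    rw [integral_prod _ hB, integral_prod _ hC, ← integral_const_mul]
    congr 1 with x
    have := integral_slice_vertical hΦ hc hs a x
    have f1 : ∀ t, inner ℝ (c t • g.1 x) (splitLast n (gradient Φ ((splitLast n).symm (x, t)))).2
        = g.1 x * (c t * (splitLast n (gradient Φ ((splitLast n).symm (x, t)))).2) := by
      intro t; simp; ring
    have f2 : ∀ t, inner ℝ (s t • g.1 x) (Φ ((splitLast n).symm (x, t)))
        = g.1 x * (s t * Φ ((splitLast n).symm (x, t))) := by
      intro t; simp; ring
    simp only [f1, f2]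
    rw [integral_const_mul, integral_const_mul, this]
    ring
  rw [eL, eR, eH, eV]
  ring

theorem inner_sobolevTensor_sobolevH10 {n : ℕ} {Ω : Set (EuclideanSpace ℝ (Fin n))} {ℓ a τ : ℝ}
    {g : L2Scalar n × L2Field n} (hg : IsDirichletEigenfunction Ω τ g)
    {w : L2Scalar (n + 1) × L2Field (n + 1)} (hw : w ∈ sobolevH10 (openCylinder Ω ℓ)) :
    inner ℝ (sobolevTensor g (sinePair ℓ a)).2 w.2 =
      (τ + a ^ 2) * inner ℝ (sobolevTensor g (sinePair ℓ a)).1 w.1 := by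
  have hcl : IsClosed {w : L2Scalar (n + 1) × L2Field (n + 1) |
      inner ℝ (sobolevTensor g (sinePair ℓ a)).2 w.2 =
        (τ + a ^ 2) * inner ℝ (sobolevTensor g (sinePair ℓ a)).1 w.1} :=
    isClosed_eq (by fun_prop) (by fun_prop)
  exact closure_minimal (fun w hw => inner_sobolevTensor_testPair hg hw) hcl hw

/-- Products of eigenfunctions on `Ω` and sines are orthogonal to the eigenfunctions on the
cylinder with a different eigenvalue. -/
theorem inner_tensorLp_eq_zero_of_ne {n : ℕ} {Ω : Set (EuclideanSpace ℝ (Fin n))} {ℓ a τ μ : ℝ}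
    (ha : a ≠ 0) (hsin : Real.sin (a * ℓ) = 0)
    {g : L2Scalar n × L2Field n} (hg : IsDirichletEigenfunction Ω τ g)
    {w : L2Scalar (n + 1) × L2Field (n + 1)}
    (hw : IsDirichletEigenfunction (openCylinder Ω ℓ) μ w) (hne : μ ≠ τ + a ^ 2) :
    inner ℝ (tensorLp g.1 (sinePair ℓ a).1) w.1 = 0 := by
  -- Each weak equation is tested with the other function. This needs the product to lie in H¹₀ of
  -- the cylinder, which is where sin(aℓ) = 0 matters.
  have h1 := inner_sobolevTensor_sobolevH10 (a := a) hg hw.1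
  have h2 := hw.2.2 _ (sobolevTensor_mem_sobolevH10 hg.1 (sinePair_mem_closure ha hsin))
  rw [real_inner_comm, h1, real_inner_comm _ w.1] at h2
  have h3 : (μ - (τ + a ^ 2)) * inner ℝ (sobolevTensor g (sinePair ℓ a)).1 w.1 = 0 := by
    rw [sub_mul, h2, sub_self]
  exact (mul_eq_zero.1 h3).resolve_left (sub_ne_zero.2 hne)

/-! ### Completeness of the products on the cylinder -/

/-- Restriction to the complement of U is continuous on L² and kills all test functions, hence also
their limits. -/
theorem ae_eq_zero_of_mem_sobolevH10 {d : ℕ} {U : Set (EuclideanSpace ℝ (Fin d))}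
    (hU : MeasurableSet U) {w : L2Scalar d × L2Field d} (hw : w ∈ sobolevH10 U) :
    ∀ᵐ x ∂(volume : Measure (EuclideanSpace ℝ (Fin d))), x ∉ U → w.1 x = 0 := by
  set R := LpToLpRestrictCLM (EuclideanSpace ℝ (Fin d)) ℝ ℝ volume 2 Uᶜ
  have hcl : IsClosed {w : L2Scalar d × L2Field d | R w.1 = 0} :=
    isClosed_eq (by fun_prop) continuous_const
  have hsub : testPairs U ⊆ {w : L2Scalar d × L2Field d | R w.1 = 0} := by
    rintro p ⟨φ, -, -, hs, h1, -⟩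
    refine Lp.ext ?_
    filter_upwards [LpToLpRestrictCLM_coeFn ℝ Uᶜ p.1, ae_restrict_of_ae h1,
      ae_restrict_mem hU.compl, Lp.coeFn_zero ℝ 2 (volume.restrict Uᶜ)] with x e1 e2 e3 e4
    rw [e1, e2, e4]
    exact image_eq_zero_of_notMem_tsupport fun h => e3 (hs h)
  have h0 : R w.1 = 0 := closure_minimal hsub hcl hw
  have h1 := LpToLpRestrictCLM_coeFn ℝ Uᶜ w.1
  rw [h0] at h1
  have h2 : ∀ᵐ x ∂volume.restrict Uᶜ, w.1 x = 0 := by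
    filter_upwards [h1, Lp.coeFn_zero ℝ 2 (volume.restrict Uᶜ)] with x e1 e2
    rw [← e1, e2]; rfl
  exact (ae_restrict_iff' hU.compl).1 h2

theorem measurePreserving_splitLast_symm (n : ℕ) :
    MeasurePreserving (splitLast n).symm (volume.prod volume) volume :=
  MeasurePreserving.symm (splitLast n).toHomeomorph.toMeasurableEquiv
    (measurePreserving_splitLast n)

/-- A function on the cylinder vanishes if it is orthogonal to all products of sines and
eigenfunctions of `Ω`. -/
theorem eq_zero_of_inner_tensorLp_eq_zero {n : ℕ} {Ω : Set (EuclideanSpace ℝ (Fin n))}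
    (hΩ : IsOpen Ω) (hb : Bornology.IsBounded Ω) {ℓ : ℝ} (hℓ : 0 < ℓ) {u : L2Scalar (n + 1)}
    (hsupp : ∀ᵐ y ∂(volume : Measure (EuclideanSpace ℝ (Fin (n + 1)))),
      y ∉ openCylinder Ω ℓ → u y = 0)
    (h : ∀ j : ℕ, 1 ≤ j → ∀ τ g, IsDirichletEigenfunction Ω τ g →
      inner ℝ (tensorLp g.1 (sinePair ℓ (j * Real.pi / ℓ)).1) u = 0) : u = 0 := by
  set u' : EuclideanSpace ℝ (Fin n) × ℝ → ℝ := fun p => u ((splitLast n).symm p) with hu'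
  have hm : StronglyMeasurable u' :=
    (Lp.stronglyMeasurable u).comp_measurable (splitLast n).symm.continuous.measurable
  have hL : MemLp u' 2 (volume.prod volume) :=
    (Lp.memLp u).comp_measurePreserving (measurePreserving_splitLast_symm n)
  have hsupp' : ∀ᵐ p ∂((volume : Measure (EuclideanSpace ℝ (Fin n))).prod (volume : Measure ℝ)),
      p ∉ Ω ×ˢ Set.Ioo 0 ℓ → u' p = 0 := by
    filter_upwards [(measurePreserving_splitLast_symm n).quasiMeasurePreserving.ae hsupp]
      with p hp hnot
    exact hp (by simpa [openCylinder] using hnot)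
  have hfin : volume Ω ≠ ⊤ := hb.measure_lt_top.ne
  have hslice : ∀ j : ℕ, 1 ≤ j → ∀ᵐ x ∂(volume : Measure (EuclideanSpace ℝ (Fin n))), x ∈ Ω →
      ∫ t, (sinePair ℓ (j * Real.pi / ℓ)).1 t * u' (x, t) = 0 := by
    intro j hj
    set s := (sinePair ℓ (j * Real.pi / ℓ)).1 with hs
    -- Contracting u with s in the last variable, via the adjoint of w ↦ w ⊗ s, gives a function on
    -- ℝⁿ orthogonal to the eigenfunctions of Ω, so completeness on Ω applies.
    have hort : ∀ w ∈ sobolevH10 Ω, inner ℝ (tensorLp w.1 s) u = 0 := by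
      intro w hw
      have h1 := inner_eq_zero_of_forall_eigenfunction hΩ.measurableSet hb
        (f := ((tensorL n ℝ).flip s).adjoint u) (fun τ g hg => by
          rw [ContinuousLinearMap.adjoint_inner_right]
          exact h j hj τ g hg) hw
      rwa [ContinuousLinearMap.adjoint_inner_right] at h1
    -- The contraction x ↦ ∫ s(t) u'(x, t) dt integrates to zero against every test function on Ω.
    refine hΩ.ae_eq_zero_of_integral_contDiff_smul_eq_zero ?_ fun φ hφ hc hsub => ?_
    · refine IntegrableOn.locallyIntegrableOn ?_
      have h1 := (integrable_inner_of_memLp_two (memLp_prod_smul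
        (indicatorConstLp 2 hΩ.measurableSet hfin (1 : ℝ)) s) hL).integral_prod_left
      rw [← integrable_indicator_iff hΩ.measurableSet]
      refine h1.congr ?_
      filter_upwards [indicatorConstLp_coeFn (p := 2) (hs := hΩ.measurableSet) (hμs := hfin)
        (c := (1 : ℝ))] with x hx
      simp only [hx]
      by_cases hxΩ : x ∈ Ω
      · simp [hxΩ, mul_comm]
      · simp [hxΩ]
    · obtain ⟨p, hp, e1, -⟩ := exists_testPair hφ hc hsub
      have h0 := hort p (subset_closure hp)
      have hi := integrable_inner_of_memLp_two (memLp_prod_smul p.1 s) hL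
      have h2 : inner ℝ (tensorLp p.1 s) u = ∫ q, inner ℝ (s q.2 • p.1 q.1) (u' q)
          ∂(volume.prod volume) := by
        rw [L2.inner_def, ← (measurePreserving_splitLast n).integral_comp
          (measurableEmbedding_splitLast n)]
        refine integral_congr_ae ?_
        filter_upwards [coeFn_tensorLp p.1 s] with y hy
        simp only [hy, hu', ContinuousLinearEquiv.symm_apply_apply]
      rw [h2, integral_prod _ hi] at h0
      rw [← h0]
      refine integral_congr_ae ?_
      filter_upwards [e1] with x hx
      rw [smul_eq_mul, ← integral_const_mul]
      congr 1 with t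
      simp [hx]
      ring
  -- Only countably many j occur, so one null set serves all of them; completeness of the sines then
  -- applies to almost every vertical slice.
  have hall : ∀ᵐ x ∂(volume : Measure (EuclideanSpace ℝ (Fin n))), ∀ j : ℕ, 1 ≤ j → x ∈ Ω →
      ∫ t, (sinePair ℓ (j * Real.pi / ℓ)).1 t * u' (x, t) = 0 :=
    ae_all_iff.2 fun j => by
      by_cases hj : 1 ≤ j
      · filter_upwards [hslice j hj] with x hx _ using hx
      · exact Filter.Eventually.of_forall fun x h' => absurd h' hj
  have hzero : ∀ᵐ p ∂((volume : Measure (EuclideanSpace ℝ (Fin n))).prod (volume : Measure ℝ)),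
      u' p = 0 := by
    refine (Measure.ae_prod_iff_ae_ae (p := fun p => u' p = 0)
      (hm.measurable (measurableSet_singleton 0))).2 ?_
    filter_upwards [hall, Measure.ae_ae_of_ae_prod hsupp', hL.integrable_sq.prod_right_ae]
      with x h1 h2 h3
    by_cases hx : x ∈ Ω
    · have hmx : StronglyMeasurable fun t => u' (x, t) :=
        hm.comp_measurable measurable_prodMk_left
      refine ae_eq_zero_of_integral_sin_eq_zero hℓ
        ((memLp_two_iff_integrable_sq hmx.aestronglyMeasurable).2 h3) ?_ fun j hj => ?_
      · filter_upwards [h2] with t ht hnot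
        exact ht fun h' => hnot h'.2
      · rw [← h1 j hj hx]
        refine integral_congr_ae ?_
        filter_upwards [coeFn_sinePair_fst ℓ (j * Real.pi / ℓ), h2] with t e1 e2
        rw [e1]
        by_cases ht : t ∈ Set.Ioo 0 ℓ
        · rw [Set.indicator_of_mem ht]
        · rw [e2 fun h' => ht h'.2, mul_zero, mul_zero]
    · filter_upwards [h2] with t ht
      exact ht fun h' => hx h'.1
  refine Lp.ext ?_
  filter_upwards [(measurePreserving_splitLast n).quasiMeasurePreserving.ae hzero,
    Lp.coeFn_zero ℝ 2 (volume : Measure (EuclideanSpace ℝ (Fin (n + 1))))] with y h1 h2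
  rw [h2]
  simpa [hu'] using h1

/-! ### Finite spectral families -/

theorem IsDirichletEigenfunction.inner_eq_zero {d : ℕ} {U : Set (EuclideanSpace ℝ (Fin d))}
    {μ ν : ℝ} {g w : L2Scalar d × L2Field d} (hg : IsDirichletEigenfunction U μ g)
    (hw : IsDirichletEigenfunction U ν w) (hne : μ ≠ ν) : inner ℝ g.1 w.1 = 0 := by
  have h1 := hg.2.2 w hw.1
  have h2 := hw.2.2 g hg.1
  rw [real_inner_comm, h1, real_inner_comm] at h2
  have h3 : (μ - ν) * inner ℝ g.1 w.1 = 0 := by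
    rw [sub_mul, real_inner_comm]
    linarith
  exact (mul_eq_zero.1 h3).resolve_left (sub_ne_zero.2 hne)

theorem IsDirichletEigenfunction.norm_snd_sq {d : ℕ} {U : Set (EuclideanSpace ℝ (Fin d))}
    {μ : ℝ} {g : L2Scalar d × L2Field d} (hg : IsDirichletEigenfunction U μ g) :
    ‖g.2‖ ^ 2 = μ * ‖g.1‖ ^ 2 := by
  have := hg.2.2 g hg.1
  rwa [real_inner_self_eq_norm_sq, real_inner_self_eq_norm_sq] at this

theorem sum_smul_mem_sobolevH10 {d : ℕ} {U : Set (EuclideanSpace ℝ (Fin d))} {ι : Type*}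
    (s : Finset ι) (c : ι → ℝ) {w : ι → L2Scalar d × L2Field d} (hw : ∀ i, w i ∈ sobolevH10 U) :
    ∑ i ∈ s, c i • w i ∈ sobolevH10 U :=
  (testSubmodule U).topologicalClosure.sum_mem fun i _ =>
    (testSubmodule U).topologicalClosure.smul_mem (c i) (hw i)

theorem Orthonormal.finCons {E : Type*} [NormedAddCommGroup E] [InnerProductSpace ℝ E] {M : ℕ}
    {v : Fin M → E} (hv : Orthonormal ℝ v) {e : E} (he : ‖e‖ = 1) (hve : ∀ m, inner ℝ (v m) e = 0) :
    Orthonormal ℝ (Fin.cons e v : Fin (M + 1) → E) := by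
  refine ⟨fun i => ?_, fun i j => ?_⟩
  · refine Fin.cases ?_ (fun i => ?_) i
    · exact he
    · exact hv.1 i
  · refine Fin.cases ?_ (fun i => ?_) i <;> refine Fin.cases ?_ (fun j => ?_) j
    · exact fun h => absurd rfl h
    · intro _
      rw [Fin.cons_zero, Fin.cons_succ, real_inner_comm, hve]
    · intro _
      rw [Fin.cons_zero, Fin.cons_succ, hve]
    · intro h
      rw [Fin.cons_succ, Fin.cons_succ]
      exact hv.2 fun h' => h (by rw [h'])

/-- There is a finite orthonormal family spanning all eigenfunctions with eigenvalue at most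
`Λ`. -/
theorem exists_orthonormal_eigenfunctions {d : ℕ} (hd : 0 < d)
    {U : Set (EuclideanSpace ℝ (Fin d))} (hU : IsOpen U) (hb : Bornology.IsBounded U) {Λ : ℝ}
    (hΛ : 0 ≤ Λ) :
    ∃ (M : ℕ) (g : Fin M → L2Scalar d × L2Field d) (τ : Fin M → ℝ),
      Orthonormal ℝ (fun m => (g m).1) ∧ (∀ m, τ m ≤ Λ ∧ IsDirichletEigenfunction U (τ m) (g m)) ∧
      ∀ σ ≤ Λ, ∀ w, IsDirichletEigenfunction U σ w →
        w.1 = ∑ m, (inner ℝ (g m).1 w.1 : ℝ) • (g m).1 := by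
  let P : ℕ → Prop := fun M => ∃ (g : Fin M → L2Scalar d × L2Field d) (τ : Fin M → ℝ),
    Orthonormal ℝ (fun m => (g m).1) ∧ ∀ m, τ m ≤ Λ ∧ IsDirichletEigenfunction U (τ m) (g m)
  have hP0 : P 0 := ⟨fun m => m.elim0, fun m => m.elim0, ⟨fun m => m.elim0, fun m => m.elim0⟩,
    fun m => m.elim0⟩
  -- A family of maximal size exists: in Berezin's inequality at z = Λ + 1 every term is at least 1,
  -- which bounds M.
  obtain ⟨M, hM, hM1⟩ : ∃ M, P M ∧ ¬ P (M + 1) := by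
    by_contra! hcon
    have hall : ∀ M, P M := fun M => Nat.rec hP0 (fun k hk => hcon k hk) M
    obtain ⟨M, hM⟩ := exists_nat_gt (volume.real U * (2 / ((d : ℝ) + 2) * unitBallVolume d /
      (2 * Real.pi) ^ d * ((Λ + 1) * √(Λ + 1) ^ d)))
    obtain ⟨g, τ, ho, he⟩ := hall M
    have hB := berezin_inequality hd hU hb (by linarith : 0 ≤ Λ + 1) (fun m => (he m).2.1) ho
    have h1 : ∑ _m : Fin M, (1 : ℝ) ≤ ∑ m, (Λ + 1 - ‖(g m).2‖ ^ 2) := by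
      refine Finset.sum_le_sum fun m _ => ?_
      rw [(he m).2.norm_snd_sq, ho.1 m]
      linarith [(he m).1]
    simp only [Finset.sum_const, Finset.card_univ, Fintype.card_fin, nsmul_eq_mul, mul_one] at h1
    linarith
  obtain ⟨g, τ, ho, he⟩ := hM
  refine ⟨M, g, τ, ho, he, fun σ hσ w hw => ?_⟩
  by_contra hne
  set c : Fin M → ℝ := fun m => inner ℝ (g m).1 w.1 with hc
  set r : L2Scalar d × L2Field d := w - ∑ m, c m • g m with hr
  have hr1 : r.1 = w.1 - ∑ m, c m • (g m).1 := by
    simp [hr, Prod.fst_sum]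
  have hr2 : r.2 = w.2 - ∑ m, c m • (g m).2 := by
    simp [hr, Prod.snd_sum]
  have hr0 : r.1 ≠ 0 := by rw [hr1]; exact sub_ne_zero.2 hne
  -- Only modes with τ_m = σ contribute to the projection of w. The residual r is thus again an
  -- eigenfunction for σ, and normalised it would enlarge the maximal family.
  have hcτ : ∀ m, c m * τ m = c m * σ := by
    intro m
    by_cases h : τ m = σ
    · rw [h]
    · have : c m = 0 := (he m).2.inner_eq_zero hw h
      rw [this, zero_mul, zero_mul]
  have hrort : ∀ m, inner ℝ (g m).1 r.1 = 0 := by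
    intro m
    rw [hr1, inner_sub_right, ho.inner_right_fintype, hc, sub_self]
  have hreig : ∀ v ∈ sobolevH10 U, inner ℝ r.2 v.2 = σ * inner ℝ r.1 v.1 := by
    intro v hv
    rw [hr1, hr2, inner_sub_left, inner_sub_left, sum_inner, sum_inner, hw.2.2 v hv, mul_sub,
      Finset.mul_sum]
    congr 1
    refine Finset.sum_congr rfl fun m _ => ?_
    rw [real_inner_smul_left, real_inner_smul_left, (he m).2.2.2 v hv, ← mul_assoc, hcτ]
    ring
  have hrmem : r ∈ sobolevH10 U :=
    (testSubmodule U).topologicalClosure.sub_mem hw.1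
      (sum_smul_mem_sobolevH10 _ _ fun m => (he m).2.1)
  have hnorm : ‖r.1‖ ≠ 0 := norm_ne_zero_iff.2 hr0
  set e : L2Scalar d × L2Field d := ‖r.1‖⁻¹ • r with hedef
  have he1 : e.1 = ‖r.1‖⁻¹ • r.1 := rfl
  have he2 : e.2 = ‖r.1‖⁻¹ • r.2 := rfl
  have heig : IsDirichletEigenfunction U σ e := by
    refine ⟨(testSubmodule U).topologicalClosure.smul_mem _ hrmem, ?_, fun v hv => ?_⟩
    · rw [he1]; exact smul_ne_zero (inv_ne_zero hnorm) hr0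
    · rw [he1, he2, real_inner_smul_left, real_inner_smul_left, hreig v hv]; ring
  have henorm : ‖e.1‖ = 1 := by
    rw [he1, norm_smul, norm_inv, norm_norm, inv_mul_cancel₀ hnorm]
  have hege : ∀ m, inner ℝ (g m).1 e.1 = (0 : ℝ) := by
    intro m
    rw [he1, real_inner_smul_right, hrort, mul_zero]
  refine hM1 ⟨Fin.cons e g, Fin.cons σ τ, ?_, ?_⟩
  · have hcons : (fun m => ((Fin.cons e g : Fin (M + 1) → L2Scalar d × L2Field d) m).1) =
        (Fin.cons e.1 (fun m => (g m).1) : Fin (M + 1) → L2Scalar d) :=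
      funext fun m => Fin.cases rfl (fun _ => rfl) m
    rw [hcons]
    exact ho.finCons henorm hege
  · intro m
    refine Fin.cases ?_ (fun m => ?_) m
    · exact ⟨hσ, heig⟩
    · exact he m

/-! ### Counting the eigenvalues of the cylinder -/

theorem interior_closedCylinder {n : ℕ} {Ω : Set (EuclideanSpace ℝ (Fin n))} (hΩ : IsOpen Ω)
    (ℓ : ℝ) : interior (closedCylinder Ω ℓ) = openCylinder Ω ℓ := by
  have h : closedCylinder Ω ℓ = (splitLast n).toHomeomorph ⁻¹' (Ω ×ˢ Set.Icc 0 ℓ) := rfl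
  rw [h, ← (splitLast n).toHomeomorph.preimage_interior, interior_prod_eq, hΩ.interior_eq,
    interior_Icc]
  rfl

theorem isOpen_openCylinder {n : ℕ} {Ω : Set (EuclideanSpace ℝ (Fin n))} (hΩ : IsOpen Ω)
    (ℓ : ℝ) : IsOpen (openCylinder Ω ℓ) :=
  (hΩ.prod isOpen_Ioo).preimage (splitLast n).continuous

theorem openCylinder_nonempty {n : ℕ} {Ω : Set (EuclideanSpace ℝ (Fin n))} (hΩ : Ω.Nonempty)
    {ℓ : ℝ} (hℓ : 0 < ℓ) : (openCylinder Ω ℓ).Nonempty := by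
  obtain ⟨x, hx⟩ := hΩ
  exact ⟨(splitLast n).symm (x, ℓ / 2), by
    simpa [openCylinder, hx] using hℓ⟩

theorem isBounded_openCylinder {n : ℕ} {Ω : Set (EuclideanSpace ℝ (Fin n))}
    (hΩ : Bornology.IsBounded Ω) (ℓ : ℝ) : Bornology.IsBounded (openCylinder Ω ℓ) := by
  have h := (splitLast n).symm.lipschitz.isBounded_image (hΩ.prod (Metric.isBounded_Ioo 0 ℓ))
  have e : (splitLast n).symm '' (Ω ×ˢ Set.Ioo 0 ℓ) = openCylinder Ω ℓ :=
    (splitLast n).toEquiv.symm.image_eq_preimage_symm _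
  rwa [e] at h

theorem sin_natCast_mul_pi_div_mul {ℓ : ℝ} (hℓ : ℓ ≠ 0) (j : ℕ) :
    Real.sin (j * Real.pi / ℓ * ℓ) = 0 := by
  rw [div_mul_cancel₀ _ hℓ, Real.sin_nat_mul_pi]

/-- Independent eigenfunctions of the cylinder are counted by pairs of an eigenfunction of the
cross section and a sine. -/
theorem le_sum_floor_of_linearIndependent {n : ℕ} {Ω : Set (EuclideanSpace ℝ (Fin n))}
    (hΩ : IsOpen Ω) (hb : Bornology.IsBounded Ω) {ℓ : ℝ} (hℓ : 0 < ℓ) {Λ : ℝ}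
    {k : ℕ} {w : Fin k → L2Scalar (n + 1) × L2Field (n + 1)}
    (hli : LinearIndependent ℝ fun i => (w i).1)
    (hw : ∀ i, ∃ μ ≤ Λ, IsDirichletEigenfunction (openCylinder Ω ℓ) μ (w i))
    {M : ℕ} {g : Fin M → L2Scalar n × L2Field n} {τ : Fin M → ℝ}
    (hg : ∀ m, IsDirichletEigenfunction Ω (τ m) (g m))
    (hspan : ∀ σ ≤ Λ, ∀ v, IsDirichletEigenfunction Ω σ v →
        v.1 = ∑ m, (inner ℝ (g m).1 v.1 : ℝ) • (g m).1) :
    k ≤ ∑ m, ⌊ℓ / Real.pi * √(Λ - τ m)⌋₊ := by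
  have hpi := Real.pi_pos
  -- The pairs (m, j) with τ_m + (jπ/ℓ)² ≤ Λ. The second component counts from 0, so it stands for
  -- the frequency j = i.2 + 1.
  let I := Σ m : Fin M, Fin ⌊ℓ / Real.pi * √(Λ - τ m)⌋₊
  let s : ℕ → Lp ℝ 2 (volume : Measure ℝ) := fun j => (sinePair ℓ (j * Real.pi / ℓ)).1
  let A : (Fin k → ℝ) →ₗ[ℝ] (I → ℝ) := LinearMap.pi fun i : I =>
    (innerₛₗ ℝ (tensorLp (g i.1).1 (s (i.2 + 1)))) ∘ₗ
      Fintype.linearCombination ℝ (fun i => (w i).1)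
  have hinj : Function.Injective A := by
    rw [← LinearMap.ker_eq_bot, LinearMap.ker_eq_bot']
    intro c hc
    have hc' : ∀ (m : Fin M) (j : ℕ), 1 ≤ j → j ≤ ⌊ℓ / Real.pi * √(Λ - τ m)⌋₊ →
        inner ℝ (tensorLp (g m).1 (s j)) (∑ i, c i • (w i).1) = 0 := by
      intro m j hj1 hj2
      have := congrFun hc ⟨m, ⟨j - 1, by omega⟩⟩
      have hjj : j - 1 + 1 = j := by omega
      simpa [A, Fintype.linearCombination_apply, hjj] using this
    have hfst : (∑ i, c i • w i).1 = ∑ i, c i • (w i).1 := by simp [Prod.fst_sum]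
    have hzero : ∑ i, c i • (w i).1 = 0 := by
      refine eq_zero_of_inner_tensorLp_eq_zero hΩ hb hℓ ?_ fun j hj σ v hv => ?_
      · rw [← hfst]
        refine ae_eq_zero_of_mem_sobolevH10 (isOpen_openCylinder hΩ ℓ).measurableSet
          (sum_smul_mem_sobolevH10 _ _ fun i => ?_)
        obtain ⟨μ, -, hμ⟩ := hw i
        exact hμ.1
      · have hj0 : (0 : ℝ) < j := by exact_mod_cast hj
        -- If the product eigenvalue exceeds Λ, it differs from the eigenvalue of every w_i and
        -- orthogonality is automatic. Otherwise v expands in the g_m.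
        by_cases hσ : σ + (j * Real.pi / ℓ) ^ 2 ≤ Λ
        · have hσΛ : σ ≤ Λ := by nlinarith [sq_nonneg (j * Real.pi / ℓ)]
          have hv1 := hspan σ hσΛ v hv
          rw [hv1, ← tensorL_apply, map_sum, sum_apply, sum_inner]
          refine Finset.sum_eq_zero fun m _ => ?_
          rw [map_smul, smul_apply, real_inner_smul_left, tensorL_apply]
          -- For τ_m = σ the pair (m, j) is listed in I, so its pairing vanishes by assumption; for
          -- τ_m ≠ σ the coefficient is zero.
          by_cases hτ : τ m = σ
          · rw [hc' m j hj, mul_zero]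
            refine Nat.le_floor ?_
            rw [hτ]
            have h1 : j * Real.pi / ℓ ≤ √(Λ - σ) := Real.le_sqrt_of_sq_le (by linarith)
            calc (j : ℝ) = ℓ / Real.pi * (j * Real.pi / ℓ) := by field_simp
              _ ≤ _ := by gcongr
          · rw [(hg m).inner_eq_zero hv hτ, zero_mul]
        · rw [inner_sum]
          refine Finset.sum_eq_zero fun i _ => ?_
          obtain ⟨μ, hμΛ, hμ⟩ := hw i
          rw [real_inner_smul_right, inner_tensorLp_eq_zero_of_ne (by positivity)
            (sin_natCast_mul_pi_div_mul hℓ.ne' j) hv hμ (fun h => hσ (h ▸ hμΛ)), mul_zero]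
    exact funext fun i => Fintype.linearIndependent_iff.1 hli c hzero i
  have hrank := LinearMap.finrank_le_finrank_of_injective hinj
  simpa [I] using hrank

/-- The eigenvalue count of the cylinder in terms of the parameter `h` of the convexity bound. -/
theorem card_le_of_linearIndependent {n : ℕ} (hn : 0 < n) {Ω : Set (EuclideanSpace ℝ (Fin n))}
    (hΩ : IsOpen Ω) (hb : Bornology.IsBounded Ω) {ℓ : ℝ} (hℓ : 0 < ℓ) {Λ h : ℝ} (hΛ : 0 ≤ Λ)
    (hh : 0 < h) {k : ℕ} {w : Fin k → L2Scalar (n + 1) × L2Field (n + 1)}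
    (hli : LinearIndependent ℝ fun i => (w i).1)
    (hw : ∀ i, ∃ μ ≤ Λ, IsDirichletEigenfunction (openCylinder Ω ℓ) μ (w i)) :
    (k : ℝ) ≤ ℓ / Real.pi / (2 * √h) * (volume.real Ω * (2 / ((n : ℝ) + 2) * unitBallVolume n /
      (2 * Real.pi) ^ n * ((Λ + h) * √(Λ + h) ^ n))) := by
  have hpi := Real.pi_pos
  obtain ⟨M, g, τ, ho, he, hspan⟩ := exists_orthonormal_eigenfunctions hn hΩ hb hΛ
  have hk := le_sum_floor_of_linearIndependent hΩ hb hℓ hli hw (fun m => (he m).2) hspan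
  have hB := berezin_inequality hn hΩ hb (by linarith : 0 ≤ Λ + h) (fun m => (he m).2.1) ho
  calc (k : ℝ) ≤ ∑ m, (⌊ℓ / Real.pi * √(Λ - τ m)⌋₊ : ℝ) := by exact_mod_cast hk
    _ ≤ ∑ m, ℓ / Real.pi / (2 * √h) * (Λ + h - ‖(g m).2‖ ^ 2) := by
        refine Finset.sum_le_sum fun m _ => ?_
        rw [(he m).2.norm_snd_sq, ho.1 m, one_pow, mul_one]
        have hfl := Nat.floor_le (by positivity : 0 ≤ ℓ / Real.pi * √(Λ - τ m))
        refine hfl.trans ?_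
        rw [div_mul_eq_mul_div _ (2 * √h), mul_div_assoc]
        refine mul_le_mul_of_nonneg_left ?_ (by positivity)
        rw [le_div_iff₀ (by positivity)]
        have h1 := Real.sq_sqrt (sub_nonneg.2 (he m).1)
        have h2 := Real.sq_sqrt hh.le
        -- The inequality 2√(Λ - τ)√h ≤ (Λ - τ) + h, which makes the sum of square roots linear in
        -- τ.
        nlinarith [sq_nonneg (√(Λ - τ m) - √h)]
    _ = ℓ / Real.pi / (2 * √h) * ∑ m, (Λ + h - ‖(g m).2‖ ^ 2) := by rw [Finset.mul_sum]
    _ ≤ _ := mul_le_mul_of_nonneg_left hB (by positivity)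

/-! ### Evaluation of the constant and conclusion -/

theorem unitBallVolume_eq {d : ℕ} (hd : 0 < d) :
    unitBallVolume d = √Real.pi ^ d / Real.Gamma ((d : ℝ) / 2 + 1) := by
  have : Nonempty (Fin d) := ⟨⟨0, hd⟩⟩
  rw [unitBallVolume, Measure.real, EuclideanSpace.volume_ball]
  have := Real.Gamma_pos_of_pos (by positivity : (0 : ℝ) < (d : ℝ) / 2 + 1)
  simp [ENNReal.toReal_ofReal (by positivity : 0 ≤ √Real.pi ^ d / Real.Gamma ((d : ℝ) / 2 + 1))]

theorem rpow_two_div_pow {x : ℝ} (hx : 0 ≤ x) (n : ℕ) :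
    (x ^ (2 / ((n : ℝ) + 1))) ^ (n + 1) = x ^ 2 := by
  rw [← Real.rpow_natCast (x ^ (2 / ((n : ℝ) + 1))), ← Real.rpow_mul hx, ← Real.rpow_natCast]
  congr 1
  push_cast
  field_simp

theorem cylinderConst_pow (n : ℕ) :
    cylinderConst (n + 1) ^ (n + 1) = (((n : ℝ) + 1) / (n + 2)) ^ (n + 1) *
      (Real.pi / 4 * (n + 2)) *
      (Real.Gamma (((n : ℝ) + 2) / 2) / Real.Gamma (((n : ℝ) + 3) / 2)) ^ 2 := by
  have hpi := Real.pi_pos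
  have h1 := Real.Gamma_pos_of_pos (by positivity : 0 < ((n : ℝ) + 2) / 2)
  have h2 := Real.Gamma_pos_of_pos (by positivity : 0 < ((n : ℝ) + 3) / 2)
  rw [cylinderConst_eq (Nat.succ_pos n), mul_pow, ← Real.rpow_natCast (_ ^ (1 / _)),
    ← Real.rpow_mul (by
      push_cast
      rw [show (n : ℝ) + 1 + 1 = n + 2 by ring, show (n : ℝ) + 1 + 2 = n + 3 by ring]
      positivity), one_div_mul_cancel (by positivity), Real.rpow_one]
  push_cast
  rw [show (n : ℝ) + 1 + 1 = n + 2 by ring, show (n : ℝ) + 1 + 2 = n + 3 by ring]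
  ring

/-- Here κ stands for k/ℓ, and h = Λ/(n + 1) minimises (Λ + h)^(1 + n/2)/√h. Raising to the power n
+ 1 removes the fractional exponents, leaving an upper bound for (κ/V)². -/
theorem cylinder_lower_bound_le {n : ℕ} (hn : 0 < n) {V Λ κ : ℝ} (hV : 0 < V) (hΛ : 0 < Λ)
    (hκ : 0 ≤ κ) (h : κ ≤ 1 / Real.pi / (2 * √(Λ / (n + 1))) * (V * (2 / ((n : ℝ) + 2) *
      unitBallVolume n / (2 * Real.pi) ^ n *
      ((Λ + Λ / (n + 1)) * √(Λ + Λ / (n + 1)) ^ n)))) :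
    cylinderConst (n + 1) * (4 * Real.pi ^ 2 / unitBallVolume (n + 1) ^ (2 / ((n : ℝ) + 1))) *
      (κ / V) ^ (2 / ((n : ℝ) + 1)) ≤ Λ := by
  have hpi := Real.pi_pos
  have hG1 := Real.Gamma_pos_of_pos (by positivity : 0 < ((n : ℝ) + 2) / 2)
  have hG2 := Real.Gamma_pos_of_pos (by positivity : 0 < ((n : ℝ) + 3) / 2)
  have hω : unitBallVolume n = √Real.pi ^ n / Real.Gamma (((n : ℝ) + 2) / 2) := by
    rw [unitBallVolume_eq hn]; congr 2; ring
  have hω' : unitBallVolume (n + 1) = √Real.pi ^ (n + 1) / Real.Gamma (((n : ℝ) + 3) / 2) := by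
    rw [unitBallVolume_eq (Nat.succ_pos n)]; push_cast; congr 2; ring
  have hω0 : 0 < unitBallVolume n := by rw [hω]; positivity
  have hω0' : 0 < unitBallVolume (n + 1) := by rw [hω']; positivity
  refine le_of_pow_le_pow_left₀ (Nat.succ_ne_zero n) hΛ.le ?_
  rw [Nat.succ_eq_add_one, mul_pow, mul_pow, div_pow, rpow_two_div_pow hω0'.le,
    rpow_two_div_pow (by positivity), cylinderConst_pow]
  have hz : Λ + Λ / (n + 1) = Λ * (n + 2) / (n + 1) := by field_simp; ring
  have hsq : (κ / V) ^ 2 ≤ (unitBallVolume n / (Real.pi * ((n : ℝ) + 2) * (2 * Real.pi) ^ n)) ^ 2 *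
      (Λ ^ (n + 1) * (n + 2) ^ (n + 2) / (n + 1) ^ (n + 1)) := by
    have h1 : κ / V ≤ unitBallVolume n / (Real.pi * ((n : ℝ) + 2) * (2 * Real.pi) ^ n) *
        ((Λ + Λ / (n + 1)) * √(Λ + Λ / (n + 1)) ^ n / √(Λ / (n + 1))) := by
      rw [div_le_iff₀ hV]
      refine h.trans (le_of_eq ?_)
      field_simp
    calc (κ / V) ^ 2 ≤ (unitBallVolume n / (Real.pi * ((n : ℝ) + 2) * (2 * Real.pi) ^ n) *
        ((Λ + Λ / (n + 1)) * √(Λ + Λ / (n + 1)) ^ n / √(Λ / (n + 1)))) ^ 2 := by gcongr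
      _ = _ := by
        rw [mul_pow]
        congr 1
        rw [div_pow, mul_pow, ← pow_mul, mul_comm n 2, pow_mul, Real.sq_sqrt (by positivity),
          Real.sq_sqrt (by positivity), hz, div_pow, div_pow, mul_pow, mul_pow]
        field_simp
        ring
  -- The bound is sharp for this constant: the Gamma factors of α_{n+1}, ω_n and ω_{n+1} cancel, and
  -- so do all powers of π and n + 2.
  have hC : (((n : ℝ) + 1) / (n + 2)) ^ (n + 1) * (Real.pi / 4 * (n + 2)) *
      (Real.Gamma (((n : ℝ) + 2) / 2) / Real.Gamma (((n : ℝ) + 3) / 2)) ^ 2 *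
      ((4 * Real.pi ^ 2) ^ (n + 1) / unitBallVolume (n + 1) ^ 2) *
      ((unitBallVolume n / (Real.pi * ((n : ℝ) + 2) * (2 * Real.pi) ^ n)) ^ 2 *
      (Λ ^ (n + 1) * (n + 2) ^ (n + 2) / (n + 1) ^ (n + 1))) = Λ ^ (n + 1) := by
    rw [hω, hω', show 4 * Real.pi ^ 2 = (2 * Real.pi) ^ 2 by ring, ← pow_mul]
    have hs : √Real.pi ^ 2 = Real.pi := Real.sq_sqrt hpi.le
    have hs0 : 0 < √Real.pi := by positivity
    simp only [div_pow, mul_pow]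
    have e1 : (√Real.pi ^ (n + 1)) ^ 2 = Real.pi * (√Real.pi ^ n) ^ 2 := by
      rw [pow_succ √Real.pi n, mul_pow, hs]; ring
    rw [e1]
    field_simp
    ring
  rw [← hC]
  exact mul_le_mul_of_nonneg_left hsq (by positivity)

end

theorem theorem1 (n : ℕ) (hn : 1 ≤ n) :
    (∀ (Ω : Set (EuclideanSpace ℝ (Fin n))) (ℓ : ℝ),
      IsOpen Ω → IsConnected Ω → Bornology.IsBounded Ω → 0 < ℓ →
      ∀ k : ℕ, 1 ≤ k →
        dirichletEigenvalue (interior (closedCylinder Ω ℓ)) k ≥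
          cylinderConst (n + 1) *
            (4 * Real.pi ^ 2 / unitBallVolume (n + 1) ^ (2 / ((n : ℝ) + 1))) *
            ((k : ℝ) / (ℓ * volume.real Ω)) ^ (2 / ((n : ℝ) + 1))) ∧
    (2 ≤ n →
      berezinLiYauConst (n + 1) <
        ((n : ℝ) + 1) / (n + 2) * (Real.pi / 2) ^ (1 / ((n : ℝ) + 1)) ∧
      ((n : ℝ) + 1) / (n + 2) * (Real.pi / 2) ^ (1 / ((n : ℝ) + 1)) < cylinderConst (n + 1) ∧
      cylinderConst (n + 1) <
        ((n : ℝ) + 1) / (n + 2) * (Real.pi / 2) ^ (1 / ((n : ℝ) + 1)) *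
          (((n : ℝ) + 3) / (n + 2)) ^ (1 / ((n : ℝ) + 1)) ∧
      ((n : ℝ) + 1) / (n + 2) * (Real.pi / 2) ^ (1 / ((n : ℝ) + 1)) *
          (((n : ℝ) + 3) / (n + 2)) ^ (1 / ((n : ℝ) + 1)) < 1) := by
  refine ⟨fun Ω ℓ hΩ hconn hb hℓ k hk => ?_, cylinderConst_bounds⟩
  rw [interior_closedCylinder hΩ]
  have hvol : 0 < volume.real Ω :=
    ENNReal.toReal_pos (hΩ.measure_pos volume hconn.nonempty).ne' hb.measure_lt_top.ne
  -- The set of admissible Λ must be nonempty: the infimum of the empty set is 0 in ℝ, which would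
  -- break the lower bound.
  obtain ⟨Λ₀, w₀, hw₀⟩ := exists_linearIndependent_eigenfunctions (Nat.succ_pos n)
    (isOpen_openCylinder hΩ ℓ) (openCylinder_nonempty hconn.nonempty hℓ)
    (isBounded_openCylinder hb ℓ) k
  refine le_csInf ⟨Λ₀, w₀, hw₀⟩ ?_
  rintro Λ ⟨w, hli, hw⟩
  have hΛ : 0 ≤ Λ := by
    obtain ⟨μ, hμΛ, hμ⟩ := hw ⟨0, hk⟩
    refine le_trans ?_ hμΛ
    have h1 : 0 < ‖(w ⟨0, hk⟩).1‖ ^ 2 := by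
      have := norm_pos_iff.2 hμ.2.1
      positivity
    refine nonneg_of_mul_nonneg_left ?_ h1
    rw [← hμ.norm_snd_sq]
    positivity
  -- Passing to Λ' > Λ ≥ 0 makes h = Λ'/(n + 1) strictly positive.
  refine le_of_forall_gt_imp_ge_of_dense fun Λ' hΛ' => ?_
  have hΛ'0 : 0 < Λ' := hΛ.trans_lt hΛ'
  have hcard := card_le_of_linearIndependent hn hΩ hb hℓ hΛ'0.le
    (by positivity : 0 < Λ' / ((n : ℝ) + 1)) hli
    (fun i => (hw i).imp fun μ hμ => ⟨hμ.1.trans hΛ'.le, hμ.2⟩)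
  refine cylinder_lower_bound_le hn (by positivity) hΛ'0 (by positivity) (hcard.trans (le_of_eq ?_))
  ring
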